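/- A multi-index is a non-empty finite sequence $\alpha=(\alpha_1,\dots,\alpha_s)$ of positive integers; put $l(\alpha)=s$, $|\alpha|=\alpha_1+\cdots+\alpha_s$, $\mathcal S(\alpha)=\{\alpha_1,\alpha_1+\alpha_2,\dots,\alpha_1+\cdots+\alpha_{s-1}\}$ and $\alpha^\tau=(\alpha_s,\dots,\alpha_1)$. Let $\alpha^*$ be the multi-index of weight $m=|\alpha|$ with $\mathcal S(\alpha^*)=\{1,\dots,m-1\}\setminus\mathcal S(\alpha)$, and write $\beta\le\alpha$ if $|\beta|=|\alpha|$ and $\mathcal S(\beta)\subseteq\mathcal S(\alpha)$ (i.e. $\alpha$ is a refinement of $\beta$). Put ${}^+\alpha=(\alpha_1+1,\alpha_2,\dots,\alpha_s)$; a multi-index of this form is called admissible. Let $V$ and ${}^+V$ be the $\mathbb Q$-vector spaces with basis the multi-indices and the admissible multi-indices, respectively. Let $d,*,\tau:V\to V$ be the $\mathbb Q$-linear maps with $d(\alpha)=\sum_{\beta\le\alpha}\beta$, $*(\alpha)=\alpha^*$, $\tau(\alpha)=\alpha^\tau$, and let $\circledast:V\times V\to{}^+V$ be the $\mathbb Q$-bilinear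 map with $$(\alpha_1,\dots,\alpha_s)\circledast(\beta_1,\dots,\beta_t)=(\alpha_1+\beta_1)\,\#\,\bigl((\alpha_2,\dots,\alpha_s)\ast(\beta_2,\dots,\beta_t)\bigr),$$ where $\#$ is concatenation and, between (possibly empty) sequences, $\ast$ is the harmonic product: the empty sequence is its unit and $(a,x)\ast(b,y)=(a)\#(x\ast(b,y))+(b)\#((a,x)\ast y)+(a+b)\#(x\ast y)$. For a multi-index $\alpha$ and an admissible multi-index $\mu$ with $l(\mu)=|\alpha|=:m$, let $$\zeta_\alpha(\mu)=\sum\frac1{n_1^{\mu_1}n_2^{\mu_2}\cdots n_m^{\mu_m}},$$ where the sum is over all positive integers $n_1,\dots,n_m$ with $n_j\ge n_{j+1}$ if $j\in\mathcal S(\alpha)$ and $n_j>n_{j+1}$ if $j\in\{1,\dots,m-1\}\setminus\mathcal S(\alpha)$. Put $\zeta(\mu)=\zeta_{(l(\mu))}(\mu)$ (the usual multiple zeta value), extend $\zeta$ to ${}^+V\to\mathbb R$ by $\mathbb Q$-linearity, and let $\zeta^+:V\to\mathbb R$ be the $\mathbb Q$-linear map with $\zeta^+(\mu)=\zeta({}^+\mu)$.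 Proposition 4.30. All the series $\zeta_\alpha(\mu)$ with $\mu$ admissible and $l(\mu)=|\alpha|$ converge, and for every multi-index $\alpha=(\alpha_1,\dots,\alpha_s)$ and every integer $k\ge1$, $$\sum_{\substack{k_1+\cdots+k_s=k\\ k_1\ge1,\ k_2,\dots,k_s\ge0}}\zeta_\alpha(\underbrace{k_1+1,1,\dots,1}_{\alpha_1},\dots,\underbrace{k_s+1,1,\dots,1}_{\alpha_s})=\zeta\bigl(d(\alpha^\tau)\circledast(\underbrace{1,\dots,1}_k)\bigr).$$ Moreover, the case $k=1$ is equivalent to the duality of multiple zeta values, i.e. to the statement that $(*-\tau)(\alpha)=\alpha^*-\alpha^\tau\in\ker\zeta^+$ for all $\alpha$, in the following sense: for $k=1$ the left-hand side and the right-hand side are equal to $\zeta^+(*\,d(\alpha))$ and $\zeta^+(\tau\,d(\alpha))$, respectively, so that the relation reads $(*-\tau)d(\alpha)\in\ker\zeta^+$; and these relations span the same space as the duality relations, $(*-\tau)d(V)=(*-\tau)(V)$. -/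

import Mathlib

namespace MZV

/-- A multi-index: a non-empty finite sequence of positive integers. -/
@[ext]
structure MultiIndex where
  /-- The underlying sequence. -/
  entries : List ℕ+
  /-- The sequence is not empty. -/
  ne_nil : entries ≠ []

namespace MultiIndex

/-- The length `s` of `(α₁, …, α_s)`. -/
def length (α : MultiIndex) : ℕ := α.1.length

/-- The weight `α₁ + ⋯ + α_s`. -/
def weight (α : MultiIndex) : ℕ := (α.1.map (fun a : ℕ+ => (a : ℕ))).sum

theorem length_pos (α : MultiIndex) : 0 < α.length := List.length_pos_iff.2 α.2

/-- The first entry `α₁`. -/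
def head (α : MultiIndex) : ℕ+ := α.1.head α.2

/-- The (possibly empty) sequence `(α₂, …, α_s)`. -/
def tail (α : MultiIndex) : List ℕ+ := α.1.tail

/-- The reversed multi-index `α^τ = (α_s, …, α₁)`. -/
def reverse (α : MultiIndex) : MultiIndex :=
  ⟨α.1.reverse, fun h => α.2 (List.reverse_eq_nil_iff.1 h)⟩

/-- The multi-index `(p)` of length one. -/
def single (p : ℕ+) : MultiIndex := ⟨[p], List.cons_ne_nil _ _⟩

theorem weight_single (p : ℕ+) : (single p).weight = (p : ℕ) := by
  simp [single, weight]

/-- The multi-index `(1, …, 1)` with `k ≥ 1` ones. -/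
def ones (k : ℕ) (hk : 1 ≤ k) : MultiIndex :=
  ⟨List.replicate k 1, fun h => by
    have h' := congrArg List.length h
    rw [List.length_replicate, List.length_nil] at h'
    omega⟩

/-- The set of partial sums `{α₁, α₁ + α₂, …, α₁ + ⋯ + α_{s-1}}`. -/
def slots (α : MultiIndex) : Finset ℕ :=
  (Finset.Ico 1 α.length).image
    (fun i => ((α.1.take i).map (fun a : ℕ+ => (a : ℕ))).sum)

theorem slots_single (a : ℕ+) : slots ⟨[a], List.cons_ne_nil _ _⟩ = ∅ := by
  simp [slots, length]

theorem slots_cons (a : ℕ+) (l : List ℕ+) (hl : l ≠ []) :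
    slots ⟨a :: l, List.cons_ne_nil _ _⟩ =
      insert (a : ℕ) ((slots ⟨l, hl⟩).image (fun x => (a : ℕ) + x)) := by
  have hpos : 0 < l.length := List.length_pos_iff.2 hl
  ext x
  simp only [slots, length, Finset.mem_image, Finset.mem_insert, Finset.mem_Ico,
    List.length_cons]
  constructor
  · rintro ⟨i, ⟨h1, h2⟩, rfl⟩
    obtain ⟨j, rfl⟩ : ∃ j, i = j + 1 := ⟨i - 1, by omega⟩
    rcases Nat.eq_zero_or_pos j with rfl | hj
    · left; simp
    · right
      exact ⟨_, ⟨j, ⟨hj, by omega⟩, rfl⟩, by simp⟩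
  · rintro (rfl | ⟨y, ⟨j, ⟨h1, h2⟩, rfl⟩, rfl⟩)
    · exact ⟨1, ⟨le_refl _, by omega⟩, by simp⟩
    · exact ⟨j + 1, ⟨by omega, by omega⟩, by simp⟩

theorem weight_cons (a : ℕ+) (l : List ℕ+) (hl : l ≠ []) :
    weight ⟨a :: l, List.cons_ne_nil _ _⟩ = (a : ℕ) + weight ⟨l, hl⟩ := by
  simp [weight]

theorem slots_subset (α : MultiIndex) : slots α ⊆ Finset.Ico 1 (weight α) := by
  obtain ⟨l, hl⟩ := α
  induction l with
  | nil => exact absurd rfl hl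
  | cons a l ih =>
    by_cases h : l = []
    · subst h
      rw [slots_single]
      exact Finset.empty_subset _
    · have ha := a.pos
      have hw : 0 < weight ⟨l, h⟩ := by
        cases l with
        | nil => exact absurd rfl h
        | cons b l => have := b.pos; simp [weight]
      rw [slots_cons a l h, weight_cons a l h]
      intro x hx
      simp only [Finset.mem_insert, Finset.mem_image] at hx
      rw [Finset.mem_Ico]
      rcases hx with rfl | ⟨y, hy, rfl⟩
      · omega
      · have := Finset.mem_Ico.1 (ih h hy)
        omega

theorem slots_injective {α β : MultiIndex} (hw : weight α = weight β)
    (hs : slots α = slots β) : α = β := by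
  obtain ⟨l, hl⟩ := α
  obtain ⟨r, hr⟩ := β
  induction l generalizing r with
  | nil => exact absurd rfl hl
  | cons a l ih =>
    cases r with
    | nil => exact absurd rfl hr
    | cons b r =>
      have hmin : ∀ (c : ℕ+) (t : List ℕ+) (ht : t ≠ []),
          ∀ x ∈ slots ⟨c :: t, List.cons_ne_nil _ _⟩, (c : ℕ) ≤ x := by
        intro c t ht x hx
        rw [slots_cons c t ht] at hx
        simp only [Finset.mem_insert, Finset.mem_image] at hx
        rcases hx with rfl | ⟨y, -, rfl⟩ <;> omega
      have hmem : ∀ (c : ℕ+) (t : List ℕ+) (ht : t ≠ []),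
          (c : ℕ) ∈ slots ⟨c :: t, List.cons_ne_nil _ _⟩ := by
        intro c t ht
        rw [slots_cons c t ht]
        exact Finset.mem_insert_self _ _
      by_cases h : l = [] <;> by_cases h' : r = []
      · subst h h'
        have : (a : ℕ) = b := by simpa [weight] using hw
        have : a = b := PNat.eq this
        subst this
        rfl
      · subst h
        rw [slots_single] at hs
        have := hmem b r h'
        rw [← hs] at this
        exact absurd this (Finset.notMem_empty _)
      · subst h'
        rw [slots_single] at hs
        have := hmem a l h
        rw [hs] at this
        exact absurd this (Finset.notMem_empty _)
      · have h1 := hmin b r h' a (hs ▸ hmem a l h)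
        have h2 := hmin a l h b (hs ▸ hmem b r h')
        have hab : a = b := PNat.eq (le_antisymm h2 h1)
        subst hab
        have key : ∀ (t : List ℕ+) (ht : t ≠ []) (x : ℕ),
            x ∈ slots ⟨t, ht⟩ ↔
              0 < x ∧ (a : ℕ) + x ∈ slots ⟨a :: t, List.cons_ne_nil _ _⟩ := by
          intro t ht x
          rw [slots_cons a t ht]
          simp only [Finset.mem_insert, Finset.mem_image]
          constructor
          · intro hx
            have := Finset.mem_Ico.1 (slots_subset _ hx)
            exact ⟨by omega, Or.inr ⟨x, hx, rfl⟩⟩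
          · rintro ⟨h0, h | ⟨y, hy, hxy⟩⟩
            · omega
            · have : y = x := by omega
              exact this ▸ hy
        rw [weight_cons a l h, weight_cons a r h'] at hw
        have := ih h r h' (by omega) (by
          ext x
          rw [key l h x, key r h' x, hs])
        have hlr : l = r := congrArg MultiIndex.entries this
        subst hlr
        rfl

theorem slots_surjective (m : ℕ) (hm : 0 < m) (T : Finset ℕ) (hT : T ⊆ Finset.Ico 1 m) :
    ∃ α : MultiIndex, weight α = m ∧ slots α = T := by
  induction m using Nat.strong_induction_on generalizing T with
  | _ m ih =>
    rcases T.eq_empty_or_nonempty with rfl | hne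
    · obtain ⟨p, rfl⟩ : ∃ p : ℕ+, (p : ℕ) = m := ⟨⟨m, hm⟩, rfl⟩
      exact ⟨⟨[p], List.cons_ne_nil _ _⟩, by simp [weight], slots_single _⟩
    · set a := T.min' hne with ha
      have haT : a ∈ T := T.min'_mem hne
      have ham := Finset.mem_Ico.1 (hT haT)
      obtain ⟨β, hβw, hβs⟩ := ih (m - a) (by omega) (by omega)
        ((T.erase a).image (fun x => x - a)) (by
          intro x hx
          obtain ⟨y, hy, rfl⟩ := Finset.mem_image.1 hx
          have hyT := Finset.mem_of_mem_erase hy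
          have h1 := Finset.mem_Ico.1 (hT hyT)
          have h2 : a ≤ y := T.min'_le y hyT
          have h3 := Finset.ne_of_mem_erase hy
          rw [Finset.mem_Ico]
          omega)
      obtain ⟨l, hl⟩ := β
      obtain ⟨p, hp⟩ : ∃ p : ℕ+, (p : ℕ) = a := ⟨⟨a, by omega⟩, rfl⟩
      refine ⟨⟨p :: l, List.cons_ne_nil _ _⟩, ?_, ?_⟩
      · rw [weight_cons _ l hl, hβw, hp]
        omega
      · rw [slots_cons _ l hl, hβs, hp]
        ext x
        simp only [Finset.mem_insert, Finset.mem_image, Finset.mem_erase]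
        constructor
        · rintro (rfl | ⟨y, ⟨z, ⟨-, hz⟩, rfl⟩, rfl⟩)
          · exact haT
          · have h2 : a ≤ z := T.min'_le z hz
            have : a + (z - a) = z := by omega
            rwa [this]
        · intro hx
          by_cases hxa : x = a
          · exact Or.inl hxa
          · have h2 : a ≤ x := T.min'_le x hx
            exact Or.inr ⟨x - a, ⟨x, ⟨hxa, hx⟩, rfl⟩, by omega⟩

theorem weight_pos (α : MultiIndex) : 0 < weight α := by
  obtain ⟨l, hl⟩ := α
  cases l with
  | nil => exact absurd rfl hl
  | cons b l => have := b.pos; simp [weight]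

/-- For `m ≥ 1`, the one-to-one correspondence between the multi-indices of weight `m` and
the subsets of `{1, …, m - 1}`, given by the partial sums. -/
noncomputable def slotEquiv (m : ℕ) (hm : 0 < m) :
    {α : MultiIndex // weight α = m} ≃ {T : Finset ℕ // T ⊆ Finset.Ico 1 m} :=
  Equiv.ofBijective
    (fun α => ⟨slots α.1, by have h := slots_subset α.1; rwa [α.2] at h⟩)
    ⟨fun α β h => Subtype.ext
        (slots_injective (α.2.trans β.2.symm) (congrArg Subtype.val h)),
      fun T => by
        obtain ⟨α, hw, hs⟩ := slots_surjective m hm T.1 T.2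
        exact ⟨⟨α, hw⟩, Subtype.ext hs⟩⟩

/-- The multi-index `α^*` of the same weight `m` as `α` that corresponds to the complement
of the set of `α` in `{1, …, m - 1}`. -/
noncomputable def star (α : MultiIndex) : MultiIndex :=
  ((slotEquiv α.weight α.weight_pos).symm
    ⟨Finset.Ico 1 α.weight \ α.slots, Finset.sdiff_subset⟩).1

theorem weight_star (α : MultiIndex) : α.star.weight = α.weight :=
  ((slotEquiv α.weight α.weight_pos).symm _).2

theorem slots_star (α : MultiIndex) :
    α.star.slots = Finset.Ico 1 α.weight \ α.slots :=
  congrArg Subtype.val ((slotEquiv α.weight α.weight_pos).apply_symm_apply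
    ⟨Finset.Ico 1 α.weight \ α.slots, Finset.sdiff_subset⟩)

/-- `β` is a refinement of `α`, written `β ≥ α` or `α ≤ β`. -/
def Refines (β α : MultiIndex) : Prop := β.weight = α.weight ∧ α.slots ⊆ β.slots

theorem finite_coarsenings (α : MultiIndex) : {β : MultiIndex | α.Refines β}.Finite := by
  refine Set.Finite.of_finite_image (f := slots) ?_ ?_
  · refine (α.slots.powerset.finite_toSet).subset ?_
    rintro _ ⟨β, hβ, rfl⟩
    exact Finset.mem_coe.2 (Finset.mem_powerset.2 hβ.2)
  · intro β hβ γ hγ h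
    exact slots_injective (hβ.1.symm.trans hγ.1) h

/-- The finite set of all `β ≤ α`. -/
noncomputable def coarsenings (α : MultiIndex) : Finset MultiIndex :=
  α.finite_coarsenings.toFinset

/-- The multi-index `⁺α = (α₁ + 1, α₂, …, α_s)`. -/
def plus (α : MultiIndex) : MultiIndex := ⟨(α.head + 1) :: α.tail, List.cons_ne_nil _ _⟩

/-- `μ` is admissible when it is of the form `⁺α`, i.e. when `μ₁ ≥ 2`. -/
def Admissible (μ : MultiIndex) : Prop := ∃ α : MultiIndex, μ = α.plus

/-- The multi-index
`(k₁ + 1, 1, …, 1, k₂ + 1, 1, …, 1, …, k_s + 1, 1, …, 1)` whose successive blocks have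
lengths `α₁, …, α_s`. -/
def expand (α : MultiIndex) (κ : Fin α.length → ℕ) : MultiIndex :=
  ⟨(List.ofFn fun i : Fin α.length =>
      Nat.succPNat (κ i) :: List.replicate (((α.1.get i : ℕ+) : ℕ) - 1) 1).flatten, by
    intro h
    have h0 := List.flatten_eq_nil_iff.1 h _
      (List.mem_ofFn.2 ⟨⟨0, α.length_pos⟩, rfl⟩)
    exact List.cons_ne_nil _ _ h0⟩

theorem length_expand (α : MultiIndex) (κ : Fin α.length → ℕ) :
    (α.expand κ).length = α.weight := by
  have h : ∀ i : Fin α.length, ((α.1.get i : ℕ+) : ℕ) - 1 + 1 = ((α.1.get i : ℕ+) : ℕ) :=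
    fun i => Nat.sub_add_cancel (α.1.get i).pos
  have e : List.ofFn (fun i : Fin α.length => ((α.1.get i : ℕ+) : ℕ)) =
      α.1.map (fun a : ℕ+ => (a : ℕ)) := by
    conv_rhs => rw [← List.ofFn_get α.1, List.map_ofFn]
    rfl
  unfold length expand weight
  rw [List.length_flatten, List.map_ofFn, ← e]
  congr 2
  funext i
  simp only [Function.comp, List.length_cons, List.length_replicate]
  exact h i

end MultiIndex

open MultiIndex

/-- The summation range of `ζ_α`: sequences of `|α|` positive integers, cut into consecutive
blocks of lengths `α₁, …, α_s`, that decrease strictly inside every block and weakly from the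
last entry of a block to the first entry of the next one. Entries are numbered from `0`, so
that entry `j` is the first of a block other than the first block exactly if
`j ∈ {α₁, α₁ + α₂, …}`. -/
abbrev NestedRange (α : MultiIndex) : Type :=
  {n : Fin α.weight → ℕ+ // ∀ i j : Fin α.weight, (j : ℕ) = (i : ℕ) + 1 →
    if (j : ℕ) ∈ α.slots then n j ≤ n i else n j < n i}

/-- The general term of the series `ζ_α(μ)`. -/
noncomputable def nestedTerm (α μ : MultiIndex) (h : μ.length = α.weight)
    (n : NestedRange α) : ℝ :=
  ∏ i : Fin α.weight,
    (1 : ℝ) / (((n.1 i : ℕ+) : ℕ) : ℝ) ^ ((μ.1.get (Fin.cast h.symm i) : ℕ+) : ℕ)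

/-- The generalized nested sum `ζ_α(μ)`, for `l(μ) = |α|` and `μ` admissible. -/
noncomputable def nestedZeta (α μ : MultiIndex) (h : μ.length = α.weight) : ℝ :=
  ∑' n : NestedRange α, nestedTerm α μ h n

/-- The sum of `ζ_α(k₁ + 1, 1, …, 1, …, k_s + 1, 1, …, 1)` over all `k₁ + ⋯ + k_s = k` with
`k₁ ≥ 1` and `k₂, …, k_s ≥ 0`. -/
noncomputable def nestedSide (α : MultiIndex) (k : ℕ) : ℝ :=
  ∑ κ ∈ (Finset.piAntidiag (Finset.univ : Finset (Fin α.length)) k).filter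
      (fun κ => 1 ≤ κ ⟨0, α.length_pos⟩),
    nestedZeta α (α.expand κ) (α.length_expand κ)

/-- The set `⁺I` of admissible multi-indices. -/
abbrev AdmIndex : Type := {μ : MultiIndex // μ.Admissible}

/-- The `ℚ`-vector space with basis the multi-indices. -/
abbrev V : Type := MultiIndex →₀ ℚ

/-- The `ℚ`-vector space with basis the admissible multi-indices. -/
abbrev AdmV : Type := AdmIndex →₀ ℚ

/-- The basis vector of `V` given by a multi-index. -/
noncomputable def basisV (α : MultiIndex) : V := Finsupp.single α 1

/-- The multiple zeta value `ζ(μ₁, …, μ_p) = ζ_{(p)}(μ)` of an admissible multi-index. -/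
noncomputable def mzv (μ : AdmIndex) : ℝ :=
  nestedZeta (MultiIndex.single (Nat.toPNat μ.1.length μ.1.length_pos)) μ.1
    (by rw [weight_single]; rfl)

/-- The `ℚ`-linear extension of `ζ` to the admissible space. -/
noncomputable def zeta : AdmV →ₗ[ℚ] ℝ := Finsupp.linearCombination ℚ mzv

/-- The `ℚ`-linear map `ζ⁺` on `V` with `ζ⁺(μ) = ζ(⁺μ)`. -/
noncomputable def zetaPlus : V →ₗ[ℚ] ℝ :=
  Finsupp.linearCombination ℚ (fun μ : MultiIndex => mzv ⟨μ.plus, μ, rfl⟩)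

/-- The `ℚ`-linear map `d` with `d(α) = ∑_{β ≤ α} β`. -/
noncomputable def dMap : V →ₗ[ℚ] V :=
  Finsupp.linearCombination ℚ (fun α : MultiIndex => ∑ β ∈ α.coarsenings, basisV β)

/-- The `ℚ`-linear extension of `α ↦ α^*`. -/
noncomputable def starMap : V →ₗ[ℚ] V :=
  Finsupp.linearCombination ℚ (fun α : MultiIndex => basisV α.star)

/-- The `ℚ`-linear extension of `α ↦ α^τ`. -/
noncomputable def tauMap : V →ₗ[ℚ] V :=
  Finsupp.linearCombination ℚ (fun α : MultiIndex => basisV α.reverse)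

/-- The harmonic (stuffle) product of two sequences, as a formal sum of sequences; the empty
sequence is the unit. -/
noncomputable def harmonic : List ℕ+ → List ℕ+ → (List ℕ+ →₀ ℚ)
  | [], y => Finsupp.single y 1
  | a :: x, [] => Finsupp.single (a :: x) 1
  | a :: x, b :: y =>
      Finsupp.mapDomain (List.cons a) (harmonic x (b :: y)) +
      Finsupp.mapDomain (List.cons b) (harmonic (a :: x) y) +
      Finsupp.mapDomain (List.cons (a + b)) (harmonic x y)
termination_by x y => x.length + y.length

theorem admissible_cons_add (a b : ℕ+) (l : List ℕ+) :
    MultiIndex.Admissible ⟨(a + b) :: l, List.cons_ne_nil _ _⟩ := by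
  obtain ⟨c, hc⟩ : ∃ c : ℕ+, (c : ℕ) = (a : ℕ) + b - 1 :=
    ⟨⟨(a : ℕ) + b - 1, by have := a.pos; have := b.pos; omega⟩, rfl⟩
  have hab : a + b = c + 1 := by
    have := a.pos
    have := b.pos
    apply PNat.eq
    rw [PNat.add_coe, PNat.add_coe, hc, PNat.one_coe]
    omega
  exact ⟨⟨c :: l, List.cons_ne_nil _ _⟩, MultiIndex.ext (by simp [plus, head, tail, hab])⟩

/-- `α ⊛ β = (α₁ + β₁) # ((α₂, …, α_s) * (β₂, …, β_t))` on multi-indices, where `#` is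
concatenation and `*` the harmonic product. -/
noncomputable def circBasis (α β : MultiIndex) : AdmV :=
  Finsupp.mapDomain
    (fun l : List ℕ+ =>
      (⟨⟨(α.head + β.head) :: l, List.cons_ne_nil _ _⟩, admissible_cons_add _ _ l⟩ : AdmIndex))
    (harmonic α.tail β.tail)

/-- The `ℚ`-bilinear extension of `⊛`. -/
noncomputable def circ : V →ₗ[ℚ] V →ₗ[ℚ] AdmV :=
  Finsupp.linearCombination ℚ
    (fun α : MultiIndex => Finsupp.linearCombination ℚ (circBasis α))

end MZV

/-!
The identity is proved by the method of connected sums, with the connector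
`C(n, b) = n! b! / (n + b)!`. All terms are non-negative, so that the sums are taken in `ℝ≥0∞` and
may be exchanged freely; convergence is only needed to return to real numbers. The truncated sums
over the inner variables are finite sums in `ℝ≥0`.

In the generating series `∑ₖ xᵏ⁻¹ (…)`, the left-hand side is the nested sum in which the first
variable `n` of a block has the factor `1 / (n - x)` instead of `1 / n`, with a further factor
`1 / n₁` for the outermost variable. The right-hand side is
`∑_b (1 / b) ∏_{j < b} (1 + x / j) · W(b)`, where `W` is the weak truncated sum attached to `α^τ`:
the map `d` turns strict inequalities into weak ones (`sum_coarsenings_topSum`), and the harmonic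
product corresponds to the product of truncated sums (`harmonicEval_harmonic`).
With `P_x(b) = ∏_{j < b} (1 + x / j)`, two telescoping sums move one side to the other:

* `∑_{n ≥ m} C(n, b) / n = C(m - 1, b) / b` (`tsum_inv_mul_connector_left`);
* `∑_{c ≥ b} C(n, c) P_x(c) / c = C(n, b - 1) P_x(b) / (n - x)` (`tsum_inv_mul_connector_right`).

For `b = 1` the second one introduces the new variable. Then the variables `n₁, n₂, …` are summed
one after the other: a strict inequality inside a block leaves a factor `1 / b`
(`tsum_nestStep_strict`), and a weak inequality between two blocks becomes a weak inequality for
the new variables (`sum_tsum_nestStep_weak`). The order of the variables is reversed, which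
is why `α^τ` appears. These steps are carried out for the coefficients of the powers of `x`, so
`P_x(b)` is represented by the elementary symmetric functions `esymmInv i b` of
`1, 1/2, …, 1/(b - 1)`. The telescoping needs only `esymmInv i b = o(b)`.

Convergence of `ζ_α(μ)` follows from `∑_{n ≥ m} n⁻² ≤ 2 / m`, which removes one inner summation at a
time (`tsum_inv_sq_mul_nestStep_le`). For `k = 1`, splitting every weak inequality on the left-hand
side into a strict one and an equality gives `ζ⁺(∗ d(α))` (`unitNest_eq_sum`). Finally `d` is
surjective because it is unitriangular for refinement (`range_dMap`), so composing with `d` does not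
change the range of `∗ - τ`.
-/

namespace MZV

open MultiIndex Filter Topology
open scoped ENNReal NNReal
open Finset.HasAntidiagonal (antidiagonal)

/-! ### Telescoping sums and the swap of nested summations -/

theorem tsum_ite_le_eq_of_telescope {f g : ℕ+ → ℝ≥0∞} (h : ∀ n, f n = g n + f (n + 1))
    (h0 : Tendsto (fun j : ℕ => f j.succPNat) atTop (𝓝 0)) (m : ℕ+) :
    ∑' n, (if m ≤ n then g n else 0) = f m := by
  let φ : ℕ → ℕ+ := fun j => ⟨m + j, by have := m.pos; omega⟩
  have hφ : Function.Injective φ := fun i j hij => by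
    have := congrArg PNat.val hij
    simpa [φ] using this
  have h1 : ∑' n, (if m ≤ n then g n else 0) = ∑' j, g (φ j) := by
    rw [← hφ.tsum_eq]
    · refine tsum_congr fun j => if_pos ?_
      rw [← PNat.coe_le_coe]
      simp [φ]
    · intro n hn
      by_cases hmn : m ≤ n
      · have := PNat.coe_le_coe _ _ |>.2 hmn
        exact ⟨(n : ℕ) - m, PNat.eq (by simp [φ]; omega)⟩
      · simp [hmn] at hn
  have h2 : ∀ N : ℕ, ∑ j ∈ Finset.range N, g (φ j) + f (φ N) = f m := by
    intro N
    induction N with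
    | zero => simpa [φ] using congrArg f (PNat.eq rfl : φ 0 = m)
    | succ N ih =>
      have : φ (N + 1) = φ N + 1 := PNat.eq (by rw [PNat.add_coe]; rfl)
      rw [Finset.sum_range_succ, this, add_assoc, ← h, ih]
  have h3 : Tendsto (fun N => f (φ N)) atTop (𝓝 0) := by
    have : (fun N => f (φ N)) = (fun j : ℕ => f j.succPNat) ∘ (fun N => N + m.natPred) := by
      funext N
      refine congrArg f (PNat.eq ?_)
      have := PNat.natPred_add_one m
      simp [φ]; omega
    rw [this]
    exact h0.comp (tendsto_add_atTop_nat _)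
  have h4 := (ENNReal.tendsto_nat_tsum fun j => g (φ j)).add h3
  simp only [h2, add_zero] at h4
  rw [h1]
  exact (tendsto_nhds_unique tendsto_const_nhds h4).symm

theorem tsum_sum_Iic_comm (F : ℕ+ → ℕ+ → ℝ≥0∞) :
    ∑' n, ∑ m ∈ Finset.Iic n, F n m = ∑' m, ∑' n, if m ≤ n then F n m else 0 := by
  rw [ENNReal.tsum_comm]
  refine tsum_congr fun n => ?_
  rw [tsum_eq_sum (s := Finset.Iic n)]
  · exact Finset.sum_congr rfl fun m hm => (if_pos (Finset.mem_Iic.1 hm)).symm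
  · intro m hm
    exact if_neg fun h => hm (Finset.mem_Iic.2 h)

theorem tsum_sum_Iio_comm (F : ℕ+ → ℕ+ → ℝ≥0∞) :
    ∑' n, ∑ m ∈ Finset.Iio n, F n m = ∑' m, ∑' n, if m + 1 ≤ n then F n m else 0 := by
  rw [ENNReal.tsum_comm]
  refine tsum_congr fun n => ?_
  rw [tsum_eq_sum (s := Finset.Iio n)]
  · exact Finset.sum_congr rfl fun m hm =>
      (if_pos (Order.add_one_le_of_lt (Finset.mem_Iio.1 hm))).symm
  · intro m hm
    exact if_neg fun h => hm (Finset.mem_Iio.2 (Order.add_one_le_iff.1 h))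

/-! ### Truncated nested sums -/

/-- One summation of a nested sum: `∑ n⁻ᵉ f(n)` over `n ≤ N` for the letter `(true, e)` and over
`n < N` for the letter `(false, e)`. -/
noncomputable def nestStep (q : Bool × ℕ) (f : ℕ+ → ℝ≥0) (N : ℕ+) : ℝ≥0 :=
  ∑ n ∈ if q.1 then Finset.Iic N else Finset.Iio N, (n : ℝ≥0)⁻¹ ^ q.2 * f n

/-- The truncated nested sum `∑ n₁^{-e₁} ⋯ n_r^{-e_r} f(n_r)` with `N ≥ n₁ ≥ ⋯ ≥ n_r`, where the
inequality in front of `n_i` is weak or strict according to the Boolean of the `i`-th letter. -/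
noncomputable def nest (L : List (Bool × ℕ)) (f : ℕ+ → ℝ≥0) : ℕ+ → ℝ≥0 :=
  L.foldr nestStep f

theorem nest_nil (f : ℕ+ → ℝ≥0) : nest [] f = f := rfl

theorem nest_cons (q : Bool × ℕ) (L : List (Bool × ℕ)) (f : ℕ+ → ℝ≥0) :
    nest (q :: L) f = nestStep q (nest L f) := rfl

theorem nest_append (L L' : List (Bool × ℕ)) (f : ℕ+ → ℝ≥0) :
    nest (L ++ L') f = nest L (nest L' f) := List.foldr_append

theorem nestStep_sum {ι : Type*} (q : Bool × ℕ) (s : Finset ι) (f : ι → ℕ+ → ℝ≥0) :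
    nestStep q (∑ i ∈ s, f i) = ∑ i ∈ s, nestStep q (f i) := by
  funext N
  simp only [nestStep, Finset.sum_apply, Finset.mul_sum]
  rw [Finset.sum_comm]

theorem nest_sum {ι : Type*} (L : List (Bool × ℕ)) (s : Finset ι) (f : ι → ℕ+ → ℝ≥0) :
    nest L (∑ i ∈ s, f i) = ∑ i ∈ s, nest L (f i) := by
  induction L with
  | nil => rfl
  | cons q L ih => simp only [nest_cons, ih, nestStep_sum]

theorem inv_pnat_mul_self (n : ℕ+) : (n : ℝ≥0)⁻¹ * n = 1 :=
  inv_mul_cancel₀ (by exact_mod_cast n.ne_zero)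

/-- `esymmInv i b` is the `i`-th elementary symmetric function of `1, 1/2, …, 1/(b - 1)`. -/
noncomputable def esymmInv (i : ℕ) : ℕ+ → ℝ≥0 := nest (List.replicate i (false, 1)) 1

theorem esymmInv_zero (b : ℕ+) : esymmInv 0 b = 1 := rfl

theorem esymmInv_succ (i : ℕ) (b : ℕ+) :
    esymmInv (i + 1) b = ∑ n ∈ Finset.Iio b, (n : ℝ≥0)⁻¹ * esymmInv i n := by
  simp [esymmInv, List.replicate_succ, nest_cons, nestStep]

theorem esymmInv_succ_one (i : ℕ) : esymmInv (i + 1) 1 = 0 := by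
  rw [esymmInv_succ]
  simp

theorem sum_Iio_add_one {M : Type*} [AddCommMonoid M] (f : ℕ+ → M) (b : ℕ+) :
    ∑ n ∈ Finset.Iio (b + 1), f n = ∑ n ∈ Finset.Iio b, f n + f b := by
  rw [Finset.Iio_add_one_eq_Iic, ← Finset.Iio_insert, Finset.sum_insert (by simp), add_comm]

theorem esymmInv_succ_add_one (i : ℕ) (b : ℕ+) :
    esymmInv (i + 1) (b + 1) = esymmInv (i + 1) b + (b : ℝ≥0)⁻¹ * esymmInv i b := by
  simp only [esymmInv_succ, sum_Iio_add_one]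

theorem sum_Iio_succPNat {M : Type*} [AddCommMonoid M] (f : ℕ+ → M) (j : ℕ) :
    ∑ n ∈ Finset.Iio j.succPNat, f n = ∑ i ∈ Finset.range j, f i.succPNat := by
  induction j with
  | zero =>
    have : Finset.Iio (Nat.succPNat 0) = ∅ := Finset.Iio_bot
    simp [this]
  | succ j ih =>
    have : (j + 1).succPNat = j.succPNat + 1 := rfl
    rw [this, sum_Iio_add_one, ih, Finset.sum_range_succ]

/-- `e_i(1, …, 1/(b - 1)) = o(b)`, because `e_{i+1}(1, …, 1/(b - 1)) / b` is essentially a Cesàro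
mean of the numbers `e_i(1, …, 1/(n - 1)) / n`. -/
theorem tendsto_esymmInv_div (i : ℕ) :
    Tendsto (fun j : ℕ => ((j.succPNat : ℝ≥0)⁻¹ * esymmInv i j.succPNat : ℝ≥0)) atTop (𝓝 0) := by
  rw [← NNReal.tendsto_coe]
  induction i with
  | zero =>
    simpa [esymmInv_zero] using tendsto_one_div_add_atTop_nhds_zero_nat (𝕜 := ℝ)
  | succ i ih =>
    have h := ih.cesaro
    simp only [NNReal.coe_zero] at h ⊢
    refine squeeze_zero (fun j => NNReal.coe_nonneg _) (fun j => ?_) h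
    rw [esymmInv_succ, sum_Iio_succPNat]
    push_cast
    rcases Nat.eq_zero_or_pos j with rfl | hj
    · simp
    · refine mul_le_mul_of_nonneg_right ?_ (Finset.sum_nonneg fun _ _ => by positivity)
      have : (0 : ℝ) < j := by exact_mod_cast hj
      apply inv_anti₀ this
      simp

/-! ### The connector -/

/-- The connector `n! b! / (n + b)!`. -/
noncomputable def connector (n b : ℕ) : ℝ≥0 := (((n + b).choose b : ℕ) : ℝ≥0)⁻¹

theorem connector_comm (n b : ℕ) : connector n b = connector b n := by
  rw [connector, connector, ← Nat.choose_symm_add, add_comm]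

theorem connector_zero_left (b : ℕ) : connector 0 b = 1 := by simp [connector]

theorem connector_succ_right (n b : ℕ) :
    connector n (b + 1) * (n + b + 1) = connector n b * (b + 1) := by
  have h := Nat.add_one_mul_choose_eq (n + b) b
  have h1 : (((n + b).choose b : ℕ) : ℝ≥0) ≠ 0 := by
    exact_mod_cast (Nat.choose_pos (by omega)).ne'
  have h2 : (((n + b + 1).choose (b + 1) : ℕ) : ℝ≥0) ≠ 0 := by
    exact_mod_cast (Nat.choose_pos (by omega)).ne'
  have h' : ((n : ℝ≥0) + b + 1) * ((n + b).choose b : ℕ) =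
      ((n + b + 1).choose (b + 1) : ℕ) * ((b : ℝ≥0) + 1) := by exact_mod_cast h
  unfold connector
  rw [← add_assoc]
  field_simp
  linear_combination h'

theorem connector_coe_right (n : ℕ) (b : ℕ+) :
    connector n b * (n + b) = connector n b.natPred * b := by
  have := connector_succ_right n b.natPred
  rw [PNat.natPred_add_one] at this
  have hb : (b : ℝ≥0) = b.natPred + 1 := by exact_mod_cast (PNat.natPred_add_one b).symm
  rw [hb, ← this, add_assoc]

theorem connector_coe_left (n : ℕ+) (b : ℕ) :
    connector n b * (n + b) = connector n.natPred b * n := by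
  rw [connector_comm, connector_comm _ b, add_comm, connector_coe_right]

/-- Exchange of a factor `1 / b` for a factor `1 / n`. -/
theorem inv_mul_connector_natPred (n b : ℕ+) :
    (b : ℝ≥0)⁻¹ * connector n.natPred b = (n : ℝ≥0)⁻¹ * connector n b.natPred := by
  have h1 := connector_coe_right n b
  have h2 := connector_coe_left n b
  have hn : (n : ℝ≥0) ≠ 0 := by exact_mod_cast n.ne_zero
  have hb : (b : ℝ≥0) ≠ 0 := by exact_mod_cast b.ne_zero
  field_simp
  rw [mul_comm (b : ℝ≥0), ← h1, ← h2]

theorem connector_le_inv (n : ℕ) (b : ℕ+) : connector n b ≤ ((n : ℝ≥0) + 1)⁻¹ := by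
  have hb := PNat.natPred_add_one b
  refine inv_anti₀ (by positivity) ?_
  have : n + 1 ≤ (n + b).choose b := by
    calc n + 1 = (n + 1).choose 1 := by simp
      _ = (n + 1).choose n := by rw [Nat.choose_symm_add]
      _ ≤ (n + b).choose n := Nat.choose_le_choose n (by omega)
      _ = (n + b).choose b := by rw [Nat.choose_symm_add]
  exact_mod_cast this

/-- Summation of the connector over the first variable. -/
theorem tsum_inv_mul_connector_left (m b : ℕ+) :
    ∑' n : ℕ+, (if m ≤ n then (((n : ℝ≥0)⁻¹ * connector n b : ℝ≥0) : ℝ≥0∞) else 0) =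
      (((b : ℝ≥0)⁻¹ * connector m.natPred b : ℝ≥0) : ℝ≥0∞) := by
  refine tsum_ite_le_eq_of_telescope
    (f := fun m => (((b : ℝ≥0)⁻¹ * connector m.natPred b : ℝ≥0) : ℝ≥0∞)) (fun n => ?_) ?_ m
  · rw [← ENNReal.coe_add, ENNReal.coe_inj]
    have h2 := connector_coe_left n b
    have hn : (n : ℝ≥0) ≠ 0 := by exact_mod_cast n.ne_zero
    have hb : (b : ℝ≥0) ≠ 0 := by exact_mod_cast b.ne_zero
    have : (n + 1).natPred = n := by simp [PNat.natPred]
    rw [this]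
    field_simp
    rw [← h2]
    ring
  · simp only [Nat.natPred_succPNat]
    rw [← ENNReal.coe_zero, ENNReal.tendsto_coe]
    have h1 : Tendsto (fun n : ℕ => ((n : ℝ≥0) + 1)⁻¹) atTop (𝓝 0) := by
      rw [← NNReal.tendsto_coe]
      simpa using tendsto_one_div_add_atTop_nhds_zero_nat (𝕜 := ℝ)
    have h2 : Tendsto (fun n : ℕ => connector n b) atTop (𝓝 0) :=
      tendsto_of_tendsto_of_tendsto_of_le_of_le tendsto_const_nhds h1
        (fun _ => zero_le) (fun n => connector_le_inv n b)
    simpa using h2.const_mul (b : ℝ≥0)⁻¹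

/-- Summation of the connector, weighted with elementary symmetric functions, over the second
variable. In terms of generating series in `x`, the factor on the right-hand side is
`1 / (n - x) = ∑ x^j / n^{j+1}` times `∏_{j < b} (1 + x / j)`. -/
theorem tsum_inv_mul_connector_right (n : ℕ+) (k : ℕ) (b : ℕ+) :
    ∑' c : ℕ+, (if b ≤ c then
        (((c : ℝ≥0)⁻¹ * (connector n c * esymmInv k c) : ℝ≥0) : ℝ≥0∞) else 0) =
      ((connector n b.natPred * ∑ p ∈ antidiagonal k,
        esymmInv p.1 b * (n : ℝ≥0)⁻¹ ^ (p.2 + 1) : ℝ≥0) : ℝ≥0∞) := by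
  have hn : (n : ℝ≥0) ≠ 0 := by exact_mod_cast n.ne_zero
  refine tsum_ite_le_eq_of_telescope (f := fun b => ((connector n b.natPred *
    ∑ p ∈ antidiagonal k, esymmInv p.1 b * (n : ℝ≥0)⁻¹ ^ (p.2 + 1) : ℝ≥0) : ℝ≥0∞))
    (fun b => ?_) ?_ b
  · rw [← ENNReal.coe_add, ENNReal.coe_inj]
    have hb : (b : ℝ≥0) ≠ 0 := by exact_mod_cast b.ne_zero
    have hnn := inv_pnat_mul_self n
    have hbb := inv_pnat_mul_self b
    have hc : connector n b.natPred = connector n b * (n + b) * (b : ℝ≥0)⁻¹ := by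
      rw [connector_coe_right]; field_simp
    have hb1 : (b + 1).natPred = b := by simp [PNat.natPred]
    rw [hb1, hc]
    induction k with
    | zero =>
      simp only [Finset.Nat.antidiagonal_zero, Finset.sum_singleton, esymmInv_zero]
      linear_combination connector n b * (b : ℝ≥0)⁻¹ * hnn + connector n b * (n : ℝ≥0)⁻¹ * hbb
    | succ k ih =>
      -- The sum for `k + 1` is `1 / n` times the sum of the one for `k` and `e_{k+1}`.
      simp only [Finset.Nat.sum_antidiagonal_succ', pow_succ (_ : ℝ≥0) (_ + 1), ← mul_assoc,
        ← Finset.sum_mul]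
      simp only [zero_add, pow_one]
      rw [esymmInv_succ_add_one]
      linear_combination (n : ℝ≥0)⁻¹ * ih + connector n b * (b : ℝ≥0)⁻¹ * esymmInv (k + 1) b * hnn +
        connector n b * esymmInv (k + 1) b * (n : ℝ≥0)⁻¹ * hbb
  · simp only [Nat.natPred_succPNat]
    rw [← ENNReal.coe_zero, ENNReal.tendsto_coe]
    simp only [Finset.mul_sum]
    rw [← Finset.sum_const_zero (s := antidiagonal k)]
    refine tendsto_finsetSum _ fun p _ => ?_
    have h := (tendsto_esymmInv_div p.1).mul_const ((n : ℝ≥0)⁻¹ ^ (p.2 + 1))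
    rw [zero_mul] at h
    refine tendsto_of_tendsto_of_tendsto_of_le_of_le tendsto_const_nhds h
      (fun _ => zero_le) (fun j => ?_)
    rw [← mul_assoc]
    refine mul_le_mul_left (mul_le_mul_left ?_ _) _
    rw [connector_comm]
    exact (connector_le_inv j n).trans (by simp)

/-! ### Transport of summations through the connector -/

/-- The sum `∑_b w(b) C(n, b) e_i(1, …, 1/(b - 1))` over the second variable of the
connector `C`. -/
noncomputable def connSum (i : ℕ) (w : ℕ+ → ℝ≥0) (n : ℕ) : ℝ≥0∞ :=
  ∑' b : ℕ+, ((w b * (connector n b * esymmInv i b) : ℝ≥0) : ℝ≥0∞)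

/-- The total weight of the first variable over `n ≥ m`. With `m` replaced by `m + 1` and `m`, it
gives the strict and the weak summation. -/
theorem tsum_inv_mul_connSum (i : ℕ) (w : ℕ+ → ℝ≥0) (m : ℕ+) :
    ∑' n : ℕ+, (((n : ℝ≥0)⁻¹ : ℝ≥0) : ℝ≥0∞) * (if m ≤ n then connSum i w n else 0) =
      connSum i (fun b => (b : ℝ≥0)⁻¹ * w b) m.natPred := by
  have h : ∀ n : ℕ+, (((n : ℝ≥0)⁻¹ : ℝ≥0) : ℝ≥0∞) * (if m ≤ n then connSum i w n else 0) =
      ∑' b : ℕ+, ((w b * esymmInv i b : ℝ≥0) : ℝ≥0∞) *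
        (if m ≤ n then (((n : ℝ≥0)⁻¹ * connector n b : ℝ≥0) : ℝ≥0∞) else 0) := by
    intro n
    split_ifs
    · rw [connSum, ← ENNReal.tsum_mul_left]
      refine tsum_congr fun b => ?_
      norm_cast
      ring
    · simp
  simp only [h]
  rw [ENNReal.tsum_comm, connSum]
  refine tsum_congr fun b => ?_
  rw [ENNReal.tsum_mul_left, tsum_inv_mul_connector_left]
  norm_cast
  ring

/-- A strict summation over the first variable becomes a factor `1 / b`. -/
theorem tsum_nestStep_strict (i : ℕ) (w f : ℕ+ → ℝ≥0) :
    ∑' n : ℕ+, (((n : ℝ≥0)⁻¹ * nestStep (false, 1) f n : ℝ≥0) : ℝ≥0∞) * connSum i w n =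
      ∑' n : ℕ+, (((n : ℝ≥0)⁻¹ * f n : ℝ≥0) : ℝ≥0∞) *
        connSum i (fun b => (b : ℝ≥0)⁻¹ * w b) n := by
  have h : ∀ n : ℕ+, (((n : ℝ≥0)⁻¹ * nestStep (false, 1) f n : ℝ≥0) : ℝ≥0∞) * connSum i w n =
      ∑ m ∈ Finset.Iio n, (((m : ℝ≥0)⁻¹ * f m : ℝ≥0) : ℝ≥0∞) *
        ((((n : ℝ≥0)⁻¹ : ℝ≥0) : ℝ≥0∞) * connSum i w n) := by
    intro n
    rw [← Finset.sum_mul, nestStep, ← mul_assoc]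
    congr 1
    push_cast
    simp [mul_comm]
  simp only [h]
  rw [tsum_sum_Iio_comm]
  refine tsum_congr fun m => ?_
  have hm : (m : ℕ) = (m + 1).natPred := by simp [PNat.natPred]
  simp only [← mul_ite_zero]
  rw [ENNReal.tsum_mul_left, tsum_inv_mul_connSum, hm]

/-- A weak summation over the first variable, with the factors `1 / (n - x) = ∑ xᵖ / nᵖ⁺¹` of
the generating series, becomes a weak summation over the second variable. -/
theorem sum_tsum_nestStep_weak (k : ℕ) (w f : ℕ+ → ℝ≥0) :
    ∑ p ∈ antidiagonal k,
      ∑' n : ℕ+, (((n : ℝ≥0)⁻¹ * nestStep (true, p.2 + 1) f n : ℝ≥0) : ℝ≥0∞) * connSum p.1 w n =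
      ∑' n : ℕ+, (((n : ℝ≥0)⁻¹ * f n : ℝ≥0) : ℝ≥0∞) *
        connSum k (fun b => (b : ℝ≥0)⁻¹ * ∑ m ∈ Finset.Iic b, w m) n := by
  have h : ∀ p : ℕ × ℕ, ∀ n : ℕ+,
      (((n : ℝ≥0)⁻¹ * nestStep (true, p.2 + 1) f n : ℝ≥0) : ℝ≥0∞) * connSum p.1 w n =
      ∑ m ∈ Finset.Iic n, (((m : ℝ≥0)⁻¹ ^ (p.2 + 1) * f m : ℝ≥0) : ℝ≥0∞) *
        ((((n : ℝ≥0)⁻¹ : ℝ≥0) : ℝ≥0∞) * connSum p.1 w n) := by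
    intro p n
    rw [← Finset.sum_mul, nestStep, ← mul_assoc]
    congr 1
    push_cast
    simp [mul_comm]
  simp only [h]
  simp only [tsum_sum_Iic_comm]
  rw [← Summable.tsum_finsetSum fun _ _ => ENNReal.summable]
  refine tsum_congr fun m => ?_
  simp only [← mul_ite_zero]
  simp only [ENNReal.tsum_mul_left, tsum_inv_mul_connSum]
  have h1 : ∀ b : ℕ+, ∑ p ∈ antidiagonal k, ((((m : ℝ≥0)⁻¹ ^ (p.2 + 1) * f m : ℝ≥0) : ℝ≥0∞) *
      (((b : ℝ≥0)⁻¹ * w b * (connector m.natPred b * esymmInv p.1 b) : ℝ≥0) : ℝ≥0∞)) =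
      (((m : ℝ≥0)⁻¹ * f m : ℝ≥0) : ℝ≥0∞) * ((w b : ℝ≥0∞) * ∑' c : ℕ+, (if b ≤ c then
        (((c : ℝ≥0)⁻¹ * (connector m c * esymmInv k c) : ℝ≥0) : ℝ≥0∞) else 0)) := by
    intro b
    rw [tsum_inv_mul_connector_right]
    norm_cast
    simp only [Finset.mul_sum]
    refine Finset.sum_congr rfl fun p _ => ?_
    linear_combination ((m : ℝ≥0)⁻¹ ^ (p.2 + 1) * f m * w b * esymmInv p.1 b) *
      inv_mul_connector_natPred m b
  simp only [connSum, ← ENNReal.tsum_mul_left]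
  rw [← Summable.tsum_finsetSum fun _ _ => ENNReal.summable]
  simp only [h1]
  rw [ENNReal.tsum_mul_left, ENNReal.tsum_mul_left]
  congr 1
  have h2 : ∀ c : ℕ+, (((c : ℝ≥0)⁻¹ * ∑ b ∈ Finset.Iic c, w b) *
        (connector m c * esymmInv k c) : ℝ≥0) =
      ((∑ b ∈ Finset.Iic c, w b * ((c : ℝ≥0)⁻¹ * (connector m c * esymmInv k c)) : ℝ≥0)) := by
    intro c
    rw [← Finset.sum_mul]
    ring
  simp only [h2, ENNReal.ofNNReal_finsetSum, ENNReal.coe_mul (w _)]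
  rw [tsum_sum_Iic_comm]
  refine tsum_congr fun b => ?_
  rw [← ENNReal.tsum_mul_left]
  exact tsum_congr fun c => by rw [mul_ite_zero]

/-- The total sum over the first variable, which removes it. -/
theorem tsum_inv_mul_connSum_one (i : ℕ) (w : ℕ+ → ℝ≥0) :
    ∑' n : ℕ+, (((n : ℝ≥0)⁻¹ : ℝ≥0) : ℝ≥0∞) * connSum i w n =
      ∑' b : ℕ+, (((b : ℝ≥0)⁻¹ * w b * esymmInv i b : ℝ≥0) : ℝ≥0∞) := by
  have h := tsum_inv_mul_connSum i w 1
  simp only [one_le, if_true] at h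
  rw [h, connSum]
  simp [PNat.natPred, connector_zero_left]

/-- The letters of a block of length `a` whose first exponent is `i + 1`. -/
def blockLetters (a : ℕ+) (i : ℕ) : List (Bool × ℕ) :=
  (true, i + 1) :: List.replicate ((a : ℕ) - 1) (false, 1)

/-- The sum, over all `k₁ + ⋯ + k_s = k` with `k_i ≥ 0`, of the truncated nested sums whose blocks
have the lengths given by the list and the first exponents `k₁ + 1, …, k_s + 1`. -/
noncomputable def blockSum : List ℕ+ → ℕ → ℕ+ → ℝ≥0
  | [], k => if k = 0 then 1 else 0
  | a :: l, k => ∑ p ∈ antidiagonal k, nest (blockLetters a p.1) (blockSum l p.2)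

/-- One step of the weak sums on the other side: `b ↦ b⁻ᵃ ∑_{m ≤ b} w(m)`. -/
noncomputable def weakStep (a : ℕ+) (w : ℕ+ → ℝ≥0) (b : ℕ+) : ℝ≥0 :=
  (b : ℝ≥0)⁻¹ ^ (a : ℕ) * ∑ m ∈ Finset.Iic b, w m

theorem tsum_nest_strict (r i : ℕ) (w f : ℕ+ → ℝ≥0) :
    ∑' n : ℕ+, (((n : ℝ≥0)⁻¹ * nest (List.replicate r (false, 1)) f n : ℝ≥0) : ℝ≥0∞) *
        connSum i w n =
      ∑' n : ℕ+, (((n : ℝ≥0)⁻¹ * f n : ℝ≥0) : ℝ≥0∞) *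
        connSum i (fun b => (b : ℝ≥0)⁻¹ ^ r * w b) n := by
  induction r generalizing w with
  | zero => simp [nest_nil]
  | succ r ih =>
    rw [List.replicate_succ, nest_cons, tsum_nestStep_strict, ih]
    simp only [pow_succ, mul_assoc]

theorem inv_pow_sub_one_mul (a b : ℕ+) :
    (b : ℝ≥0)⁻¹ ^ ((a : ℕ) - 1) * (b : ℝ≥0)⁻¹ = (b : ℝ≥0)⁻¹ ^ (a : ℕ) := by
  rw [← pow_succ, Nat.sub_add_cancel a.pos]

theorem sum_tsum_nest_block (a : ℕ+) (k : ℕ) (w f : ℕ+ → ℝ≥0) :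
    ∑ p ∈ antidiagonal k,
      ∑' n : ℕ+, (((n : ℝ≥0)⁻¹ * nest (blockLetters a p.2) f n : ℝ≥0) : ℝ≥0∞) *
        connSum p.1 w n =
      ∑' n : ℕ+, (((n : ℝ≥0)⁻¹ * f n : ℝ≥0) : ℝ≥0∞) * connSum k (weakStep a w) n := by
  simp only [blockLetters, nest_cons]
  rw [sum_tsum_nestStep_weak, tsum_nest_strict]
  simp only [← mul_assoc, inv_pow_sub_one_mul]
  rfl

theorem sum_antidiagonal_assoc {M : Type*} [AddCommMonoid M] (k : ℕ) (g : ℕ → ℕ → ℕ → M) :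
    ∑ p ∈ antidiagonal k, ∑ q ∈ antidiagonal p.2, g p.1 q.1 q.2 =
      ∑ p ∈ antidiagonal k, ∑ q ∈ antidiagonal p.1, g q.1 q.2 p.2 := by
  rw [Finset.sum_sigma', Finset.sum_sigma']
  refine Finset.sum_nbij' (fun x => ⟨(x.1.1 + x.2.1, x.2.2), (x.1.1, x.2.1)⟩)
    (fun x => ⟨(x.2.1, x.2.2 + x.1.2), (x.2.2, x.1.2)⟩) ?_ ?_ ?_ ?_ ?_
  all_goals
    rintro ⟨⟨a, b⟩, ⟨c, d⟩⟩ h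
    simp only [Finset.mem_sigma, Finset.HasAntidiagonal.mem_antidiagonal] at h ⊢
  · exact ⟨by omega, trivial⟩
  · exact ⟨by omega, trivial⟩
  · rw [h.2]
  · rw [h.2]

/-- The transport of all summations of a nested sum through the connector. -/
theorem sum_tsum_blockSum (l : List ℕ+) (k : ℕ) (w : ℕ+ → ℝ≥0) :
    ∑ p ∈ antidiagonal k,
      ∑' n : ℕ+, (((n : ℝ≥0)⁻¹ * blockSum l p.2 n : ℝ≥0) : ℝ≥0∞) * connSum p.1 w n =
      ∑' b : ℕ+, (((b : ℝ≥0)⁻¹ * l.foldl (fun v a => weakStep a v) w b * esymmInv k b : ℝ≥0) :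
        ℝ≥0∞) := by
  induction l generalizing k w with
  | nil =>
    rw [Finset.sum_eq_single (k, 0)]
    · simp only [blockSum, if_true, Pi.one_apply, mul_one, List.foldl_nil]
      exact tsum_inv_mul_connSum_one k w
    · rintro ⟨i, j⟩ hij hne
      have : j ≠ 0 := by
        rintro rfl
        simp at hij
        simp [hij] at hne
      simp [blockSum, this]
    · simp
  | cons a l ih =>
    rw [List.foldl_cons, ← ih]
    simp only [← sum_tsum_nest_block]
    have h : ∀ p : ℕ × ℕ,
        ∑' n : ℕ+, (((n : ℝ≥0)⁻¹ * blockSum (a :: l) p.2 n : ℝ≥0) : ℝ≥0∞) * connSum p.1 w n =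
        ∑ q ∈ antidiagonal p.2, ∑' n : ℕ+, (((n : ℝ≥0)⁻¹ *
          nest (blockLetters a q.1) (blockSum l q.2) n : ℝ≥0) : ℝ≥0∞) * connSum p.1 w n := by
      intro p
      rw [← Summable.tsum_finsetSum fun _ _ => ENNReal.summable]
      refine tsum_congr fun n => ?_
      rw [← Finset.sum_mul, blockSum, Finset.sum_apply, Finset.mul_sum, ENNReal.ofNNReal_finsetSum]
    simp only [h]
    exact sum_antidiagonal_assoc k fun i p j => ∑' n : ℕ+, (((n : ℝ≥0)⁻¹ *
      nest (blockLetters a p) (blockSum l j) n : ℝ≥0) : ℝ≥0∞) * connSum i w n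

/-! ### Convergence -/

theorem tsum_inv_sq_ge_le (m : ℕ+) :
    ∑' n : ℕ+, (if m ≤ n then (((n : ℝ≥0)⁻¹ ^ 2 : ℝ≥0) : ℝ≥0∞) else 0) ≤
      ((2 * (m : ℝ≥0)⁻¹ : ℝ≥0) : ℝ≥0∞) := by
  have h := tsum_inv_mul_connector_left m 1
  have h1 : connector m.natPred (1 : ℕ+) = (m : ℝ≥0)⁻¹ := by
    simp [connector]
  rw [h1] at h
  rw [ENNReal.coe_mul, show ((m : ℝ≥0)⁻¹ : ℝ≥0) = ((1 : ℕ+) : ℝ≥0)⁻¹ * (m : ℝ≥0)⁻¹ by simp, ← h,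
    ← ENNReal.tsum_mul_left]
  refine ENNReal.tsum_le_tsum fun n => ?_
  split_ifs
  · rw [← ENNReal.coe_mul, ENNReal.coe_le_coe]
    have h2 : connector n (1 : ℕ+) = ((n : ℝ≥0) + 1)⁻¹ := by simp [connector]
    have hn : (1 : ℝ≥0) ≤ n := by exact_mod_cast n.pos
    have h3 : (n : ℝ≥0)⁻¹ ≤ 2 * ((n : ℝ≥0) + 1)⁻¹ := by
      rw [← div_eq_mul_inv, inv_eq_one_div, div_le_div_iff₀ (by positivity) (by positivity),
        one_mul,
        two_mul]
      gcongr
    rw [h2, pow_two, mul_left_comm]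
    gcongr
  · simp

theorem tsum_inv_sq_mul_nestStep_le (q : Bool × ℕ) (hq : 1 ≤ q.2) (f : ℕ+ → ℝ≥0) :
    ∑' n : ℕ+, (((n : ℝ≥0)⁻¹ ^ 2 * nestStep q f n : ℝ≥0) : ℝ≥0∞) ≤
      2 * ∑' n : ℕ+, (((n : ℝ≥0)⁻¹ ^ 2 * f n : ℝ≥0) : ℝ≥0∞) := by
  calc ∑' n : ℕ+, (((n : ℝ≥0)⁻¹ ^ 2 * nestStep q f n : ℝ≥0) : ℝ≥0∞)
      ≤ ∑' n : ℕ+, ∑ m ∈ Finset.Iic n, (((m : ℝ≥0)⁻¹ * f m : ℝ≥0) : ℝ≥0∞) *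
          (((n : ℝ≥0)⁻¹ ^ 2 : ℝ≥0) : ℝ≥0∞) := by
        refine ENNReal.tsum_le_tsum fun n => ?_
        rw [← Finset.sum_mul, ← ENNReal.ofNNReal_finsetSum, ← ENNReal.coe_mul, ENNReal.coe_le_coe,
          mul_comm]
        gcongr
        refine (Finset.sum_le_sum_of_subset (t := Finset.Iic n) ?_).trans
          (Finset.sum_le_sum fun m _ => ?_)
        · split_ifs
          · exact subset_rfl
          · exact Finset.Iio_subset_Iic_self
        · gcongr
          refine pow_le_of_le_one zero_le (inv_le_one_of_one_le₀ ?_) (by omega)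
          exact_mod_cast m.pos
    _ = ∑' m : ℕ+, (((m : ℝ≥0)⁻¹ * f m : ℝ≥0) : ℝ≥0∞) *
          ∑' n : ℕ+, (if m ≤ n then (((n : ℝ≥0)⁻¹ ^ 2 : ℝ≥0) : ℝ≥0∞) else 0) := by
        rw [tsum_sum_Iic_comm]
        refine tsum_congr fun m => ?_
        rw [← ENNReal.tsum_mul_left]
        exact tsum_congr fun n => (mul_ite_zero _ _ _).symm
    _ ≤ ∑' m : ℕ+, (((m : ℝ≥0)⁻¹ * f m : ℝ≥0) : ℝ≥0∞) * ((2 * (m : ℝ≥0)⁻¹ : ℝ≥0) : ℝ≥0∞) :=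
        ENNReal.tsum_le_tsum fun m => mul_le_mul_right (tsum_inv_sq_ge_le m) _
    _ = 2 * ∑' n : ℕ+, (((n : ℝ≥0)⁻¹ ^ 2 * f n : ℝ≥0) : ℝ≥0∞) := by
        rw [← ENNReal.tsum_mul_left]
        refine tsum_congr fun m => ?_
        norm_cast
        ring

theorem tsum_inv_pow_mul_nest_ne_top {e : ℕ} (he : 2 ≤ e) (L : List (Bool × ℕ))
    (hL : ∀ q ∈ L, 1 ≤ q.2) :
    ∑' n : ℕ+, (((n : ℝ≥0)⁻¹ ^ e * nest L 1 n : ℝ≥0) : ℝ≥0∞) ≠ ⊤ := by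
  have h2 : ∑' n : ℕ+, (((n : ℝ≥0)⁻¹ ^ 2 * nest L 1 n : ℝ≥0) : ℝ≥0∞) ≠ ⊤ := by
    induction L with
    | nil =>
      have h := tsum_inv_sq_ge_le 1
      simp only [one_le, if_true] at h
      simpa [nest_nil] using ne_top_of_le_ne_top ENNReal.coe_ne_top h
    | cons q L ih =>
      refine ne_top_of_le_ne_top (ENNReal.mul_ne_top ENNReal.ofNat_ne_top
        (ih fun q hq => hL q (List.mem_cons_of_mem _ hq)))
        (tsum_inv_sq_mul_nestStep_le q (hL q List.mem_cons_self) _)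
  refine ne_top_of_le_ne_top h2 (ENNReal.tsum_le_tsum fun n => ENNReal.coe_le_coe.2 ?_)
  gcongr ?_ * _
  refine pow_le_pow_of_le_one zero_le (inv_le_one_of_one_le₀ ?_) he
  exact_mod_cast n.pos

/-! ### Nested sums as iterated sums -/

/-- The chain of inequalities prescribed by the letters of `L`, apart from the first one. -/
def IsChainFor (L : List (Bool × ℕ)) (n : Fin L.length → ℕ+) : Prop :=
  ∀ i j : Fin L.length, (j : ℕ) = i + 1 → if (L.get j).1 then n j ≤ n i else n j < n i

/-- The inequality between the bound `N` and the first variable prescribed by the first letter. -/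
def IsBoundedFor (L : List (Bool × ℕ)) (N : ℕ+) (n : Fin L.length → ℕ+) : Prop :=
  ∀ j : Fin L.length, (j : ℕ) = 0 → if (L.get j).1 then n j ≤ N else n j < N

theorem isChainFor_cons (q : Bool × ℕ) (L : List (Bool × ℕ)) (a : ℕ+) (n : Fin L.length → ℕ+) :
    IsChainFor (q :: L) (Fin.cons a n : Fin (L.length + 1) → ℕ+) ↔
      IsBoundedFor L a n ∧ IsChainFor L n := by
  constructor
  · intro h
    refine ⟨fun j hj => ?_, fun i j hij => ?_⟩
    · simpa using h (0 : Fin (L.length + 1)) (Fin.succ j) (by simp [hj])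
    · simpa using h (Fin.succ i) (Fin.succ j) (by simp [hij])
  · rintro ⟨h1, h2⟩ i j hij
    change Fin (L.length + 1) at i j
    induction j using Fin.cases with
    | zero => simp at hij
    | succ j =>
      induction i using Fin.cases with
      | zero => simpa using h1 j (by simpa using hij)
      | succ i => simpa using h2 i j (by simpa using hij)

theorem isBoundedFor_cons (q : Bool × ℕ) (L : List (Bool × ℕ)) (N a : ℕ+)
    (n : Fin L.length → ℕ+) :
    IsBoundedFor (q :: L) N (Fin.cons a n : Fin (L.length + 1) → ℕ+) ↔
      a ∈ if q.1 then Finset.Iic N else Finset.Iio N := by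
  constructor
  · intro h
    have := h (0 : Fin (L.length + 1)) rfl
    split_ifs at this ⊢ with h' <;> simp_all
  · intro h j hj
    change Fin (L.length + 1) at j
    obtain rfl : j = 0 := Fin.ext hj
    split_ifs at h ⊢ with h' <;> simp_all

theorem tsum_fin_cons (r : ℕ) (F : (Fin (r + 1) → ℕ+) → ℝ≥0∞) :
    ∑' n, F n = ∑' a, ∑' n : Fin r → ℕ+, F (Fin.cons a n) := by
  rw [← (Fin.consEquiv fun _ : Fin (r + 1) => ℕ+).tsum_eq, ← ENNReal.tsum_prod]
  rfl

open Classical in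
theorem tsum_isChainFor_isBoundedFor (L : List (Bool × ℕ)) (N : ℕ+) :
    ∑' n : Fin L.length → ℕ+, (if IsBoundedFor L N n ∧ IsChainFor L n then
      ((∏ i, (n i : ℝ≥0)⁻¹ ^ (L.get i).2 : ℝ≥0) : ℝ≥0∞) else 0) = nest L 1 N := by
  induction L generalizing N with
  | nil =>
    rw [tsum_eq_single (fun i => i.elim0) fun n hn => absurd (funext fun i => i.elim0) hn]
    rw [if_pos ⟨fun i => i.elim0, fun i => i.elim0⟩]
    simp [nest_nil]
  | cons q L ih =>
    rw [nest_cons, nestStep, ENNReal.ofNNReal_finsetSum]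
    refine (tsum_fin_cons L.length _).trans ?_
    rw [tsum_eq_sum (s := if q.1 then Finset.Iic N else Finset.Iio N)]
    · refine Finset.sum_congr rfl fun a ha => ?_
      rw [ENNReal.coe_mul, ← ih, ← ENNReal.tsum_mul_left]
      refine tsum_congr fun n => ?_
      rw [isChainFor_cons, isBoundedFor_cons, mul_ite_zero]
      simp only [ha, true_and]
      congr 1
      rw [← ENNReal.coe_mul, ENNReal.coe_inj]
      exact Fin.prod_univ_succ _
    · intro a ha
      refine ENNReal.tsum_eq_zero.2 fun n => if_neg fun h => ha ?_
      exact (isBoundedFor_cons q L N a n).1 h.1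

open Classical in
theorem tsum_isChainFor (q : Bool × ℕ) (L : List (Bool × ℕ)) :
    ∑' n : Fin (q :: L).length → ℕ+, (if IsChainFor (q :: L) n then
      ((∏ i, (n i : ℝ≥0)⁻¹ ^ ((q :: L).get i).2 : ℝ≥0) : ℝ≥0∞) else 0) =
      ∑' a : ℕ+, (((a : ℝ≥0)⁻¹ ^ q.2 * nest L 1 a : ℝ≥0) : ℝ≥0∞) := by
  refine (tsum_fin_cons L.length _).trans (tsum_congr fun a => ?_)
  rw [ENNReal.coe_mul, ← tsum_isChainFor_isBoundedFor, ← ENNReal.tsum_mul_left]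
  refine tsum_congr fun n => ?_
  rw [isChainFor_cons, mul_ite_zero]
  congr 1
  rw [← ENNReal.coe_mul, ENNReal.coe_inj]
  exact Fin.prod_univ_succ _

open Classical in
theorem tsum_subtype_chain (r : ℕ) (S : Finset ℕ) (e : Fin r → ℕ) (q : Bool × ℕ)
    (L : List (Bool × ℕ)) (hr : (q :: L).length = r)
    (hS : ∀ i : Fin (q :: L).length, (i : ℕ) ≠ 0 → (((q :: L).get i).1 = true ↔ (i : ℕ) ∈ S))
    (he : ∀ i : Fin (q :: L).length, ((q :: L).get i).2 = e (Fin.cast hr i)) :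
    ∑' n : {n : Fin r → ℕ+ // ∀ i j : Fin r, (j : ℕ) = (i : ℕ) + 1 →
        if (j : ℕ) ∈ S then n j ≤ n i else n j < n i},
      ((∏ i, (n.1 i : ℝ≥0)⁻¹ ^ e i : ℝ≥0) : ℝ≥0∞) =
      ∑' a : ℕ+, (((a : ℝ≥0)⁻¹ ^ q.2 * nest L 1 a : ℝ≥0) : ℝ≥0∞) := by
  subst hr
  rw [← tsum_isChainFor]
  refine (tsum_subtype {n : Fin (q :: L).length → ℕ+ | ∀ i j : Fin (q :: L).length,
    (j : ℕ) = (i : ℕ) + 1 → if (j : ℕ) ∈ S then n j ≤ n i else n j < n i}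
    (fun n => ((∏ i, (n i : ℝ≥0)⁻¹ ^ e i : ℝ≥0) : ℝ≥0∞))).trans (tsum_congr fun n => ?_)
  have h : IsChainFor (q :: L) n ↔ ∀ i j : Fin (q :: L).length, (j : ℕ) = (i : ℕ) + 1 →
      if (j : ℕ) ∈ S then n j ≤ n i else n j < n i := by
    refine forall_congr' fun i => forall_congr' fun j => forall_congr' fun hij => ?_
    simp only [hS j (by omega)]
  simp only [Set.indicator_apply, Set.mem_ofPred_eq, h, he, Fin.cast_eq_self]

/-- The Booleans telling, for every position of a sequence cut into blocks of the given lengths,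
whether a block starts there. -/
def blockFlags (l : List ℕ+) : List Bool :=
  l.flatMap fun a => true :: List.replicate ((a : ℕ) - 1) false

theorem blockFlags_cons (a : ℕ+) (l : List ℕ+) :
    blockFlags (a :: l) = true :: (List.replicate ((a : ℕ) - 1) false ++ blockFlags l) := rfl

theorem length_blockFlags (l : List ℕ+) :
    (blockFlags l).length = (l.map fun a : ℕ+ => (a : ℕ)).sum := by
  induction l with
  | nil => rfl
  | cons a l ih =>
    have := a.pos
    rw [blockFlags_cons, List.map_cons, List.sum_cons, ← ih, List.length_cons, List.length_append,
      List.length_replicate]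
    omega

/-- A block starts at the position `0` and at the partial sums of the lengths. -/
theorem getElem_blockFlags (l : List ℕ+) (hl : l ≠ []) (j : ℕ) (hj : j < (blockFlags l).length) :
    (blockFlags l)[j] = true ↔ j = 0 ∨ j ∈ slots ⟨l, hl⟩ := by
  induction l generalizing j with
  | nil => exact absurd rfl hl
  | cons a l ih =>
    have ha := a.pos
    rcases Nat.eq_zero_or_pos j with rfl | hj0
    · simp [blockFlags_cons]
    obtain ⟨i, rfl⟩ : ∃ i, j = i + 1 := ⟨j - 1, by omega⟩
    simp only [blockFlags_cons, List.getElem_cons_succ]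
    by_cases h : l = []
    · subst h
      rw [slots_single]
      simp [blockFlags]
    · rw [slots_cons a l h]
      simp only [Finset.mem_insert, Finset.mem_image]
      by_cases hi : i < (a : ℕ) - 1
      · rw [List.getElem_append_left (by simpa using hi)]
        simp only [List.getElem_replicate]
        constructor
        · simp
        · rintro (h | h | ⟨y, -, h⟩) <;> omega
      · rw [List.getElem_append_right (by simpa using hi), ih h]
        simp only [List.length_replicate]
        constructor
        · rintro (h | h)
          · right; left; omega
          · right; right; exact ⟨_, h, by omega⟩
        · rintro (h | h | ⟨y, hy, h⟩)
          · omega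
          · left; omega
          · right
            convert hy using 1
            omega

/-- The letters of the nested sum `ζ_α(μ)`. -/
def letters (α μ : MultiIndex) : List (Bool × ℕ) :=
  (blockFlags α.1).zip (μ.1.map fun a : ℕ+ => (a : ℕ))

theorem letters_eq_cons (α μ : MultiIndex) :
    letters α μ = (true, (μ.head : ℕ)) :: (letters α μ).tail := by
  obtain ⟨l, hl⟩ := α
  obtain ⟨r, hr⟩ := μ
  cases l with
  | nil => exact absurd rfl hl
  | cons a l =>
    cases r with
    | nil => exact absurd rfl hr
    | cons b r => rfl

theorem nestedTerm_nonneg (α μ : MultiIndex) (h : μ.length = α.weight) (n : NestedRange α) :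
    0 ≤ nestedTerm α μ h n := Finset.prod_nonneg fun i _ => by positivity

theorem tsum_nestedTerm (α μ : MultiIndex) (h : μ.length = α.weight) :
    ∑' n, ENNReal.ofReal (nestedTerm α μ h n) =
      ∑' a : ℕ+, (((a : ℝ≥0)⁻¹ ^ (μ.head : ℕ) * nest (letters α μ).tail 1 a : ℝ≥0) : ℝ≥0∞) := by
  have hα : (blockFlags α.1).length = α.weight := length_blockFlags α.1
  have hμ : (μ.1.map fun a : ℕ+ => (a : ℕ)).length = α.weight := by rw [List.length_map]; exact h
  have hlen : (letters α μ).length = α.weight := by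
    rw [letters, List.length_zip, hα, hμ, min_self]
  have h1 : ∀ n, ENNReal.ofReal (nestedTerm α μ h n) = ((∏ i, (n.1 i : ℝ≥0)⁻¹ ^
      ((μ.1.get (Fin.cast h.symm i) : ℕ+) : ℕ) : ℝ≥0) : ℝ≥0∞) := by
    intro n
    rw [ENNReal.ofReal, ENNReal.coe_inj]
    refine NNReal.eq ?_
    rw [Real.coe_toNNReal _ (nestedTerm_nonneg α μ h n), nestedTerm, NNReal.coe_prod]
    refine Finset.prod_congr rfl fun i _ => ?_
    rw [one_div, ← inv_pow]
    rfl
  simp only [h1]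
  have h2 := letters_eq_cons α μ
  have hlen' := hlen
  rw [h2] at hlen'
  refine tsum_subtype_chain α.weight α.slots _ (true, (μ.head : ℕ)) (letters α μ).tail hlen' ?_ ?_
  · rintro ⟨i, hi⟩ hi0
    have hi' : i < (blockFlags α.1).length := by rw [hα, ← hlen']; exact hi
    have h3 := getElem_blockFlags α.1 α.2 i hi'
    simp only [ne_eq] at hi0
    simp only [hi0, false_or] at h3
    rw [← h3]
    simp only [List.get_eq_getElem, ← h2]
    simp [letters]
  · rintro ⟨i, hi⟩
    simp only [List.get_eq_getElem, ← h2]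
    simp [letters]
    rfl

theorem one_le_of_mem_letters {α μ : MultiIndex} {q : Bool × ℕ} (hq : q ∈ letters α μ) :
    1 ≤ q.2 := by
  obtain ⟨a, b⟩ := q
  have := (List.of_mem_zip hq).2
  obtain ⟨c, -, rfl⟩ := List.mem_map.1 this
  exact c.pos

theorem two_le_head_of_admissible {μ : MultiIndex} (hμ : μ.Admissible) : 2 ≤ (μ.head : ℕ) := by
  obtain ⟨α, rfl⟩ := hμ
  have := α.head.pos
  change 2 ≤ ((α.head + 1 : ℕ+) : ℕ)
  rw [PNat.add_coe]
  simp only [PNat.one_coe]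
  omega

theorem tsum_nestedTerm_ne_top (α μ : MultiIndex) (hμ : 2 ≤ (μ.head : ℕ)) :
    ∑' a : ℕ+, (((a : ℝ≥0)⁻¹ ^ (μ.head : ℕ) * nest (letters α μ).tail 1 a : ℝ≥0) : ℝ≥0∞) ≠ ⊤ :=
  tsum_inv_pow_mul_nest_ne_top hμ _ fun _ hq =>
    one_le_of_mem_letters (List.mem_of_mem_tail hq)

theorem summable_nestedTerm (α μ : MultiIndex) (h : μ.length = α.weight) (hμ : μ.Admissible) :
    Summable (nestedTerm α μ h) := by
  have h1 := tsum_nestedTerm_ne_top α μ (two_le_head_of_admissible hμ)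
  rw [← tsum_nestedTerm α μ h] at h1
  have h2 := ENNReal.summable_toReal h1
  simpa only [ENNReal.toReal_ofReal (nestedTerm_nonneg α μ h _)] using h2

theorem nestedZeta_eq_toReal (α μ : MultiIndex) (h : μ.length = α.weight) :
    nestedZeta α μ h = (∑' a : ℕ+, (((a : ℝ≥0)⁻¹ ^ (μ.head : ℕ) *
      nest (letters α μ).tail 1 a : ℝ≥0) : ℝ≥0∞)).toReal := by
  rw [← tsum_nestedTerm α μ h, ENNReal.tsum_toReal_eq fun _ => ENNReal.ofReal_ne_top, nestedZeta]
  exact tsum_congr fun n => (ENNReal.toReal_ofReal (nestedTerm_nonneg α μ h n)).symm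

/-! ### The sum over the exponents of the blocks -/

/-- The weight `1 / b` turns the connector into the coefficient `1 / nⁱ⁺¹` of `1 / (n - x)`; this
introduces the second variable. -/
theorem connSum_inv (i : ℕ) (n : ℕ+) :
    connSum i (fun b => (b : ℝ≥0)⁻¹) n = (((n : ℝ≥0)⁻¹ ^ (i + 1) : ℝ≥0) : ℝ≥0∞) := by
  have h := tsum_inv_mul_connector_right n i 1
  simp only [one_le, if_true] at h
  rw [connSum, h, ENNReal.coe_inj, Finset.sum_eq_single (0, i)]
  · simp [esymmInv_zero, connector, PNat.natPred]
  · rintro ⟨a, b⟩ hab hne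
    cases a with
    | zero =>
      simp at hab
      simp [hab] at hne
    | succ a => simp [esymmInv_succ_one]
  · simp

theorem sum_piAntidiag_fin_succ {M : Type*} [AddCommMonoid M] (r k : ℕ)
    (F : (Fin (r + 1) → ℕ) → M) :
    ∑ κ ∈ Finset.piAntidiag Finset.univ k, F κ =
      ∑ p ∈ antidiagonal k, ∑ κ ∈ Finset.piAntidiag (Finset.univ : Finset (Fin r)) p.2,
        F (Fin.cons p.1 κ) := by
  rw [Finset.sum_sigma']
  refine Finset.sum_nbij' (fun κ => ⟨(κ 0, ∑ i, Fin.tail κ i), Fin.tail κ⟩)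
    (fun x => Fin.cons x.1.1 x.2) ?_ ?_ ?_ ?_ ?_
  · intro κ h
    simp only [Finset.mem_piAntidiag, Fin.sum_univ_succ] at h
    simp [← h.1, Fin.tail_def]
  · rintro ⟨⟨i, j⟩, κ⟩ h
    simp only [Finset.mem_sigma, Finset.HasAntidiagonal.mem_antidiagonal,
      Finset.mem_piAntidiag] at h
    simp [Fin.sum_univ_succ, h]
  · intro κ _
    exact Fin.cons_self_tail κ
  · rintro ⟨⟨i, j⟩, κ⟩ h
    simp only [Finset.mem_sigma, Finset.HasAntidiagonal.mem_antidiagonal,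
      Finset.mem_piAntidiag] at h
    simp [h]
  · intro κ _
    rw [Fin.cons_self_tail]

/-- The letters of the nested sum with blocks of the given lengths whose first exponents are
the `κ_i + 1`. -/
def blocksLetters (l : List ℕ+) (κ : Fin l.length → ℕ) : List (Bool × ℕ) :=
  (List.ofFn fun i => blockLetters (l.get i) (κ i)).flatten

theorem blocksLetters_cons (a : ℕ+) (l : List ℕ+) (κ : Fin (l.length + 1) → ℕ) :
    blocksLetters (a :: l) κ = blockLetters a (κ 0) ++ blocksLetters l (fun i => κ i.succ) := by
  change (List.ofFn fun i : Fin (l.length + 1) => _).flatten = _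
  rw [List.ofFn_succ, List.flatten_cons]
  rfl

theorem sum_nest_blocksLetters (l : List ℕ+) (k : ℕ) :
    ∑ κ ∈ Finset.piAntidiag Finset.univ k, nest (blocksLetters l κ) 1 = blockSum l k := by
  induction l generalizing k with
  | nil =>
    change ∑ κ ∈ Finset.piAntidiag (Finset.univ : Finset (Fin 0)) k, _ = _
    rw [Finset.univ_eq_empty, Finset.piAntidiag_empty, blockSum]
    split_ifs
    · rw [Finset.sum_singleton]
      rfl
    · rfl
  | cons a l ih =>
    rw [blockSum]
    refine (sum_piAntidiag_fin_succ l.length k _).trans (Finset.sum_congr rfl fun p _ => ?_)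
    rw [← ih, nest_sum]
    refine Finset.sum_congr rfl fun κ _ => ?_
    rw [blocksLetters_cons, nest_append]
    rfl

theorem zip_blockFlags_expand (l : List ℕ+) (κ : Fin l.length → ℕ) :
    (blockFlags l).zip (((List.ofFn fun i : Fin l.length =>
      Nat.succPNat (κ i) :: List.replicate (((l.get i : ℕ+) : ℕ) - 1) 1).flatten).map
        fun a : ℕ+ => (a : ℕ)) = blocksLetters l κ := by
  induction l with
  | nil => rfl
  | cons a l ih =>
    change Fin (l.length + 1) → ℕ at κ
    rw [blocksLetters_cons, ← ih]
    change (blockFlags (a :: l)).zip (List.map _ (List.flatten (List.ofFn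
      fun i : Fin (l.length + 1) => _))) = _
    rw [List.ofFn_succ, List.flatten_cons, List.map_append]
    change ((true :: List.replicate ((a : ℕ) - 1) false) ++ blockFlags l).zip _ = _
    rw [List.zip_append (by simp)]
    congr 1
    simp [blockLetters, List.zip_replicate']

theorem letters_expand (α : MultiIndex) (κ : Fin α.length → ℕ) :
    letters α (α.expand κ) = blocksLetters α.1 κ := zip_blockFlags_expand α.1 κ

theorem head_expand (α : MultiIndex) (κ : Fin α.length → ℕ) :
    ((α.expand κ).head : ℕ) = κ ⟨0, α.length_pos⟩ + 1 := by
  obtain ⟨l, hl⟩ := α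
  cases l with
  | nil => exact absurd rfl hl
  | cons a l =>
    have h := letters_eq_cons ⟨a :: l, hl⟩ (expand ⟨a :: l, hl⟩ κ)
    rw [letters_expand] at h
    have h' := (blocksLetters_cons a l κ).symm.trans h
    simp only [blockLetters, List.cons_append, List.cons.injEq, Prod.mk.injEq] at h'
    exact h'.1.2.symm

/-- The weak truncated sum `∑ n₁^{-α₁} ⋯ n_s^{-α_s}` over `b = n₁ ≥ n₂ ≥ ⋯ ≥ n_s`; for the empty
sequence it is `1` at `b = 1` and `0` elsewhere, so that the innermost sum is equal to `1`. -/
noncomputable def weakSum (l : List ℕ+) : ℕ+ → ℝ≥0 :=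
  l.foldr weakStep (Pi.single 1 1)

theorem weakStep_single (a : ℕ+) (b : ℕ+) :
    weakStep a (Pi.single 1 1) b = (b : ℝ≥0)⁻¹ ^ (a : ℕ) := by
  rw [weakStep, Finset.sum_eq_single 1]
  · simp
  · intro c _ hc
    rw [Pi.single_eq_of_ne hc]
  · intro h
    exact absurd (Finset.mem_Iic.2 (one_le (a := b))) h

theorem nestedZeta_expand (α : MultiIndex) (κ : Fin α.length → ℕ) :
    nestedZeta α (α.expand κ) (α.length_expand κ) =
      (∑' n : ℕ+, (((n : ℝ≥0)⁻¹ ^ (κ ⟨0, α.length_pos⟩ + 1) *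
        nest (blocksLetters α.1 κ).tail 1 n : ℝ≥0) : ℝ≥0∞)).toReal := by
  rw [nestedZeta_eq_toReal, letters_expand, head_expand]

theorem one_le_of_mem_blocksLetters {α : MultiIndex} {κ : Fin α.length → ℕ} {q : Bool × ℕ}
    (hq : q ∈ blocksLetters α.1 κ) : 1 ≤ q.2 := by
  rw [← letters_expand] at hq
  exact one_le_of_mem_letters hq

/-- The left-hand side of the relation, after the transport through the connector. -/
theorem nestedSide_succ (α : MultiIndex) (k : ℕ) :
    nestedSide α (k + 1) = (∑' b : ℕ+,
      (((b : ℝ≥0)⁻¹ * weakSum α.1.reverse b * esymmInv k b : ℝ≥0) : ℝ≥0∞)).toReal := by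
  obtain ⟨l, hl⟩ := α
  cases l with
  | nil => exact absurd rfl hl
  | cons a l =>
  have h1 : ∀ κ : Fin (l.length + 1) → ℕ, nestedZeta ⟨a :: l, hl⟩ (expand ⟨a :: l, hl⟩ κ)
      (length_expand ⟨a :: l, hl⟩ κ) = (∑' n : ℕ+, (((n : ℝ≥0)⁻¹ ^ (κ 0 + 1) *
        nest (List.replicate ((a : ℕ) - 1) (false, 1))
          (nest (blocksLetters l (fun i => κ i.succ)) 1) n : ℝ≥0) : ℝ≥0∞)).toReal := by
    intro κ
    rw [← nest_append]
    exact (nestedZeta_expand ⟨a :: l, hl⟩ κ).trans (congrArg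
      (fun L : List (Bool × ℕ) => (∑' n : ℕ+, (((n : ℝ≥0)⁻¹ ^ (κ 0 + 1) *
        nest L.tail 1 n : ℝ≥0) : ℝ≥0∞)).toReal) (blocksLetters_cons a l κ))
  have h2 : ∀ κ : Fin (l.length + 1) → ℕ, 1 ≤ κ 0 → (∑' n : ℕ+, (((n : ℝ≥0)⁻¹ ^ (κ 0 + 1) *
        nest (List.replicate ((a : ℕ) - 1) (false, 1))
          (nest (blocksLetters l (fun i => κ i.succ)) 1) n : ℝ≥0) : ℝ≥0∞)) ≠ ⊤ := by
    intro κ hκ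
    rw [← nest_append]
    refine tsum_inv_pow_mul_nest_ne_top (by omega) _ fun q hq => ?_
    have h3 : q ∈ blocksLetters (a :: l) κ := by
      rw [blocksLetters_cons]
      exact List.mem_cons_of_mem _ hq
    exact one_le_of_mem_blocksLetters (α := ⟨a :: l, hl⟩) (κ := κ) h3
  rw [nestedSide, Finset.sum_filter]
  refine (sum_piAntidiag_fin_succ l.length (k + 1) _).trans ?_
  -- The condition `k₁ ≥ 1` removes one term and shifts the first index of the others.
  rw [Finset.Nat.sum_antidiagonal_succ]
  have h4 : ∀ p : ℕ × ℕ, ∑ κ ∈ Finset.piAntidiag (Finset.univ : Finset (Fin l.length)) p.2,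
      ∑' n : ℕ+, (((n : ℝ≥0)⁻¹ ^ (p.1 + 1 + 1) *
        nest (List.replicate ((a : ℕ) - 1) (false, 1)) (nest (blocksLetters l κ) 1) n : ℝ≥0) :
          ℝ≥0∞) =
      ∑' n : ℕ+, (((n : ℝ≥0)⁻¹ * nest (List.replicate ((a : ℕ) - 1) (false, 1))
        (blockSum l p.2) n : ℝ≥0) : ℝ≥0∞) * connSum p.1 (fun b => (b : ℝ≥0)⁻¹) n := by
    intro p
    rw [← Summable.tsum_finsetSum fun _ _ => ENNReal.summable]
    refine tsum_congr fun n => ?_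
    rw [connSum_inv, ← sum_nest_blocksLetters, nest_sum, Finset.sum_apply]
    norm_cast
    rw [Finset.mul_sum, Finset.sum_mul]
    exact Finset.sum_congr rfl fun κ _ => by ring
  calc _ = ∑ p ∈ antidiagonal k, ∑ κ ∈ Finset.piAntidiag (Finset.univ : Finset (Fin l.length)) p.2,
      (∑' n : ℕ+, (((n : ℝ≥0)⁻¹ ^ (p.1 + 1 + 1) *
        nest (List.replicate ((a : ℕ) - 1) (false, 1)) (nest (blocksLetters l κ) 1) n : ℝ≥0) :
          ℝ≥0∞)).toReal := by
        refine (congrArg₂ _ (Finset.sum_eq_zero fun κ _ => if_neg ?_)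
          (Finset.sum_congr rfl fun p _ => Finset.sum_congr rfl fun κ _ =>
            (if_pos ?_).trans (h1 _))).trans (zero_add _)
        · exact Nat.not_succ_le_zero 0
        · exact Nat.succ_pos p.1
    _ = (∑ p ∈ antidiagonal k, ∑' n : ℕ+, (((n : ℝ≥0)⁻¹ *
        nest (List.replicate ((a : ℕ) - 1) (false, 1)) (blockSum l p.2) n : ℝ≥0) : ℝ≥0∞) *
          connSum p.1 (fun b => (b : ℝ≥0)⁻¹) n).toReal := by
        simp only [← h4]
        have h5 : ∀ (p : ℕ × ℕ) (κ : Fin l.length → ℕ), ∑' n : ℕ+, (((n : ℝ≥0)⁻¹ ^ (p.1 + 1 + 1) *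
            nest (List.replicate ((a : ℕ) - 1) (false, 1)) (nest (blocksLetters l κ) 1) n :
              ℝ≥0) : ℝ≥0∞) ≠ ⊤ := fun p κ =>
          h2 (Fin.cons (p.1 + 1) κ) (Nat.succ_pos p.1)
        rw [ENNReal.toReal_sum fun p _ => ENNReal.sum_ne_top.2 fun κ _ => h5 p κ]
        refine Finset.sum_congr rfl fun p _ => ?_
        rw [ENNReal.toReal_sum fun κ _ => h5 p κ]
    _ = _ := by
        simp only [tsum_nest_strict]
        rw [sum_tsum_blockSum]
        have h5 : (fun b : ℕ+ => (b : ℝ≥0)⁻¹ ^ ((a : ℕ) - 1) * (b : ℝ≥0)⁻¹) =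
            weakStep a (Pi.single 1 1) := by
          funext b
          rw [inv_pow_sub_one_mul, weakStep_single]
        rw [h5, weakSum, List.foldr_reverse, List.foldl_cons]

/-! ### Truncated multiple harmonic sums and the harmonic product -/

/-- The strict truncated sum `∑ n₁^{-a₁} ⋯ n_r^{-a_r}` over `N > n₁ > ⋯ > n_r`. -/
noncomputable def harmonicSum (l : List ℕ+) : ℕ+ → ℝ≥0 :=
  nest (l.map fun a : ℕ+ => (false, (a : ℕ))) 1

theorem harmonicSum_nil (N : ℕ+) : harmonicSum [] N = 1 := rfl

theorem harmonicSum_cons (a : ℕ+) (l : List ℕ+) (N : ℕ+) :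
    harmonicSum (a :: l) N = ∑ n ∈ Finset.Iio N, (n : ℝ≥0)⁻¹ ^ (a : ℕ) * harmonicSum l n := by
  simp [harmonicSum, nest_cons, nestStep]

theorem harmonicSum_replicate_one (i : ℕ) : harmonicSum (List.replicate i 1) = esymmInv i := by
  simp [harmonicSum, esymmInv]

/-- The linear extension of `l ↦ harmonicSum l N` to formal sums of sequences. -/
noncomputable def harmonicEval (N : ℕ+) : (List ℕ+ →₀ ℚ) →ₗ[ℚ] ℝ :=
  Finsupp.linearCombination ℚ fun l => (harmonicSum l N : ℝ)

theorem harmonicEval_single (N : ℕ+) (l : List ℕ+) :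
    harmonicEval N (Finsupp.single l 1) = harmonicSum l N := by
  simp [harmonicEval]

theorem harmonicEval_mapDomain_cons (N a : ℕ+) (v : List ℕ+ →₀ ℚ) :
    harmonicEval N (Finsupp.mapDomain (List.cons a) v) =
      ∑ n ∈ Finset.Iio N, ((n : ℝ)⁻¹ ^ (a : ℕ)) * harmonicEval n v := by
  induction v using Finsupp.induction_linear with
  | zero => simp
  | add u v hu hv =>
    rw [Finsupp.mapDomain_add, map_add, hu, hv, ← Finset.sum_add_distrib]
    simp only [map_add, mul_add]
  | single l c =>
    rw [Finsupp.mapDomain_single]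
    simp only [harmonicEval, Finsupp.linearCombination_single, harmonicSum_cons]
    push_cast
    rw [Finset.smul_sum]
    simp only [mul_smul_comm]

theorem sum_Iio_mul_sum_Iio (u v : ℕ+ → ℝ) (N : ℕ+) :
    (∑ n ∈ Finset.Iio N, u n) * ∑ n ∈ Finset.Iio N, v n =
      ∑ n ∈ Finset.Iio N, u n * ∑ m ∈ Finset.Iio n, v m +
      ∑ n ∈ Finset.Iio N, v n * ∑ m ∈ Finset.Iio n, u m +
      ∑ n ∈ Finset.Iio N, u n * v n := by
  induction N using PNat.recOn with
  | one =>
    simp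
  | succ N ih =>
    simp only [sum_Iio_add_one]
    linear_combination ih

/-- Truncated sums turn the harmonic product into the product of numbers. -/
theorem harmonicEval_harmonic (x y : List ℕ+) (N : ℕ+) :
    harmonicEval N (harmonic x y) = harmonicSum x N * harmonicSum y N := by
  induction x, y using harmonic.induct generalizing N with
  | case1 y => rw [harmonic, harmonicEval_single, harmonicSum_nil]; simp
  | case2 a x => rw [harmonic, harmonicEval_single, harmonicSum_nil]; simp
  | case3 a x b y ih1 ih2 ih3 =>
    rw [harmonic, map_add, map_add]
    simp only [harmonicEval_mapDomain_cons, ih1, ih2, ih3]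
    simp only [harmonicSum_cons a x, harmonicSum_cons b y]
    push_cast
    rw [sum_Iio_mul_sum_Iio]
    refine congrArg₂ _ (congrArg₂ _ ?_ ?_) ?_ <;> refine Finset.sum_congr rfl fun n _ => ?_
    · ring
    · ring
    · ring

/-- The strict truncated sum `∑ n₁^{-β₁} ⋯ n_t^{-β_t}` over `n = n₁ > ⋯ > n_t`. -/
noncomputable def topSum (β : MultiIndex) (n : ℕ+) : ℝ≥0 :=
  (n : ℝ≥0)⁻¹ ^ (β.head : ℕ) * harmonicSum β.tail n

theorem harmonicSum_entries (β : MultiIndex) (N : ℕ+) :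
    harmonicSum β.1 N = ∑ n ∈ Finset.Iio N, topSum β n := by
  obtain ⟨l, hl⟩ := β
  cases l with
  | nil => exact absurd rfl hl
  | cons b l => exact harmonicSum_cons b l N

theorem zip_replicate_false (l : List ℕ+) :
    (List.replicate l.length false).zip (l.map fun a : ℕ+ => (a : ℕ)) =
      l.map fun a : ℕ+ => (false, (a : ℕ)) := by
  induction l with
  | nil => rfl
  | cons b l ih =>
    rw [List.length_cons, List.replicate_succ, List.map_cons, List.map_cons, List.zip_cons_cons, ih]

theorem hasSum_mzv (μ : AdmIndex) : HasSum (fun n => (topSum μ.1 n : ℝ)) (mzv μ) := by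
  have h1 : (letters (single (Nat.toPNat μ.1.length μ.1.length_pos)) μ.1).tail =
      μ.1.tail.map fun a : ℕ+ => (false, (a : ℕ)) := by
    obtain ⟨⟨l, hl⟩, hμ⟩ := μ
    cases l with
    | nil => exact absurd rfl hl
    | cons a l =>
      change (List.replicate ((l.length + 1) - 1) false ++ []).zip (l.map fun a : ℕ+ => (a : ℕ)) =
        l.map fun a : ℕ+ => (false, (a : ℕ))
      rw [List.append_nil, Nat.add_sub_cancel]
      exact zip_replicate_false l
  have h2 := tsum_nestedTerm_ne_top (single (Nat.toPNat μ.1.length μ.1.length_pos)) μ.1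
    (two_le_head_of_admissible μ.2)
  rw [mzv, nestedZeta_eq_toReal]
  rw [h1] at h2 ⊢
  rw [ENNReal.tsum_toReal_eq fun _ => ENNReal.coe_ne_top]
  exact (ENNReal.summable_toReal h2).hasSum

/-- The linear extension of `μ ↦ topSum μ n` to the admissible space. -/
noncomputable def topEval (n : ℕ+) : AdmV →ₗ[ℚ] ℝ :=
  Finsupp.linearCombination ℚ fun μ : AdmIndex => (topSum μ.1 n : ℝ)

theorem hasSum_zeta (v : AdmV) : HasSum (fun n => topEval n v) (zeta v) := by
  induction v using Finsupp.induction_linear with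
  | zero => simp
  | add u v hu hv =>
    simp only [map_add]
    exact hu.add hv
  | single μ c =>
    simp only [topEval, zeta, Finsupp.linearCombination_single]
    exact (hasSum_mzv μ).const_smul c

theorem topEval_circBasis (α β : MultiIndex) (n : ℕ+) :
    topEval n (circBasis α β) = topSum α n * topSum β n := by
  have h : ∀ v : List ℕ+ →₀ ℚ, topEval n (Finsupp.mapDomain (fun l : List ℕ+ =>
      (⟨⟨(α.head + β.head) :: l, List.cons_ne_nil _ _⟩, admissible_cons_add _ _ l⟩ : AdmIndex)) v) =
      (n : ℝ)⁻¹ ^ ((α.head : ℕ) + β.head) * harmonicEval n v := by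
    intro v
    induction v using Finsupp.induction_linear with
    | zero => simp
    | add u v hu hv => rw [Finsupp.mapDomain_add, map_add, map_add, hu, hv, mul_add]
    | single l c =>
      rw [Finsupp.mapDomain_single]
      simp only [topEval, harmonicEval, Finsupp.linearCombination_single, topSum]
      rw [mul_smul_comm]
      push_cast
      simp [head, tail]
  rw [circBasis, h, harmonicEval_harmonic, topSum, topSum]
  push_cast
  ring

/-! ### Coarsenings -/

namespace MultiIndex

/-- The multi-index `(a, β₁, …, β_t)`. -/
def cons (a : ℕ+) (β : MultiIndex) : MultiIndex := ⟨a :: β.1, List.cons_ne_nil _ _⟩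

/-- The multi-index `(a + β₁, β₂, …, β_t)`. -/
def merge (a : ℕ+) (β : MultiIndex) : MultiIndex :=
  ⟨(a + β.head) :: β.tail, List.cons_ne_nil _ _⟩

theorem plus_eq_merge (β : MultiIndex) : β.plus = merge 1 β := by
  exact MultiIndex.ext (by simp [plus, merge, add_comm])

@[elab_as_elim]
theorem cons_induction {P : MultiIndex → Prop} (h1 : ∀ a, P (single a))
    (h2 : ∀ a β, P β → P (cons a β)) (α : MultiIndex) : P α := by
  obtain ⟨l, hl⟩ := α
  induction l with
  | nil => exact absurd rfl hl
  | cons a l ih =>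
    by_cases h : l = []
    · subst h
      exact h1 a
    · exact h2 a ⟨l, h⟩ (ih h)

/-- Every multi-index arises from `(1)` by inserting a new first entry `1` and by increasing the
first entry by `1`. -/
@[elab_as_elim]
theorem cons_merge_induction {P : MultiIndex → Prop} (h1 : P (single 1))
    (h2 : ∀ β, P β → P (cons 1 β)) (h3 : ∀ β, P β → P (merge 1 β)) (α : MultiIndex) : P α := by
  induction α using cons_induction with
  | h1 a =>
    induction a using PNat.recOn with
    | one => exact h1
    | succ a ih =>
      have := h3 _ ih
      rwa [← plus_eq_merge] at this
  | h2 a β ih =>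
    induction a using PNat.recOn with
    | one => exact h2 β ih
    | succ a ih' =>
      have := h3 _ ih'
      rwa [← plus_eq_merge] at this

theorem weight_cons' (a : ℕ+) (β : MultiIndex) : (cons a β).weight = a + β.weight :=
  weight_cons a β.1 β.2

theorem slots_cons' (a : ℕ+) (β : MultiIndex) :
    (cons a β).slots = insert (a : ℕ) (β.slots.image fun x => (a : ℕ) + x) :=
  slots_cons a β.1 β.2

theorem weight_merge (a : ℕ+) (β : MultiIndex) : (merge a β).weight = a + β.weight := by
  obtain ⟨l, hl⟩ := β
  cases l with
  | nil => exact absurd rfl hl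
  | cons b l => simp [merge, weight, head, tail, add_assoc]

theorem slots_merge (a : ℕ+) (β : MultiIndex) :
    (merge a β).slots = β.slots.image fun x => (a : ℕ) + x := by
  obtain ⟨l, hl⟩ := β
  cases l with
  | nil => exact absurd rfl hl
  | cons b l =>
    by_cases h : l = []
    · subst h
      simp only [merge, head, tail, List.head_cons, List.tail_cons, slots_single,
        Finset.image_empty]
    · simp only [merge, head, tail, List.head_cons, List.tail_cons, slots_cons _ l h,
        Finset.image_insert, Finset.image_image, PNat.add_coe]
      congr 2
      funext x
      simp [add_assoc]

theorem mem_coarsenings {α β : MultiIndex} :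
    β ∈ α.coarsenings ↔ α.weight = β.weight ∧ β.slots ⊆ α.slots := by
  rw [coarsenings, Set.Finite.mem_toFinset]
  rfl

theorem pos_of_mem_slots {α : MultiIndex} {x : ℕ} (hx : x ∈ α.slots) : 0 < x :=
  (Finset.mem_Ico.1 (slots_subset α hx)).1

theorem cons_injective (a : ℕ+) : Function.Injective (cons a) := by
  intro β γ h
  have := congrArg MultiIndex.entries h
  exact MultiIndex.ext (List.cons.inj this).2

theorem merge_injective (a : ℕ+) : Function.Injective (merge a) := by
  intro β γ h
  have hw := congrArg weight h
  have hs := congrArg slots h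
  rw [weight_merge, weight_merge] at hw
  rw [slots_merge, slots_merge] at hs
  exact slots_injective (by omega) (Finset.image_injective (fun x y hxy => by simpa using hxy) hs)

theorem coarsenings_single (a : ℕ+) : (single a).coarsenings = {single a} := by
  ext β
  rw [mem_coarsenings, Finset.mem_singleton]
  constructor
  · rintro ⟨hw, hs⟩
    refine slots_injective hw.symm ?_
    rw [single, slots_single] at hs ⊢
    exact Finset.subset_empty.1 hs
  · rintro rfl
    exact ⟨rfl, subset_rfl⟩

theorem notMem_slots_merge (a : ℕ+) (β : MultiIndex) : (a : ℕ) ∉ (merge a β).slots := by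
  rw [slots_merge]
  intro h
  obtain ⟨x, hx, hx'⟩ := Finset.mem_image.1 h
  have := pos_of_mem_slots hx
  omega

open Classical in
/-- A coarsening of `(a, β₁, …, β_t)` keeps the partial sum `a` or drops it. -/
theorem coarsenings_cons (a : ℕ+) (β : MultiIndex) :
    (cons a β).coarsenings = β.coarsenings.image (cons a) ∪ β.coarsenings.image (merge a) := by
  have hinj : Function.Injective fun x => (a : ℕ) + x := fun x y hxy => by simpa using hxy
  ext γ
  simp only [Finset.mem_union, Finset.mem_image, mem_coarsenings]
  constructor
  · rintro ⟨hw, hs⟩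
    rw [weight_cons'] at hw
    rw [slots_cons'] at hs
    obtain ⟨δ, hδw, hδs⟩ := slots_surjective β.weight β.weight_pos
      (β.slots.filter fun x => (a : ℕ) + x ∈ γ.slots)
      ((Finset.filter_subset _ _).trans (slots_subset β))
    have hδ : β.weight = δ.weight ∧ δ.slots ⊆ β.slots :=
      ⟨hδw.symm, hδs ▸ Finset.filter_subset _ _⟩
    have hmem : ∀ x, x ∈ γ.slots → x ≠ a → ∃ y ∈ δ.slots, (a : ℕ) + y = x := by
      intro x hx hxa
      rcases Finset.mem_insert.1 (hs hx) with h | h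
      · exact absurd h hxa
      · obtain ⟨y, hy, rfl⟩ := Finset.mem_image.1 h
        exact ⟨y, hδs ▸ Finset.mem_filter.2 ⟨hy, hx⟩, rfl⟩
    have hmem' : ∀ y ∈ δ.slots, (a : ℕ) + y ∈ γ.slots := by
      intro y hy
      rw [hδs] at hy
      exact (Finset.mem_filter.1 hy).2
    by_cases ha : (a : ℕ) ∈ γ.slots
    · refine Or.inl ⟨δ, hδ, slots_injective (by rw [weight_cons']; omega) ?_⟩
      rw [slots_cons']
      ext x
      simp only [Finset.mem_insert, Finset.mem_image]
      constructor
      · rintro (rfl | ⟨y, hy, rfl⟩)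
        · exact ha
        · exact hmem' y hy
      · intro hx
        by_cases hxa : x = a
        · exact Or.inl hxa
        · exact Or.inr (hmem x hx hxa)
    · refine Or.inr ⟨δ, hδ, slots_injective (by rw [weight_merge]; omega) ?_⟩
      rw [slots_merge]
      ext x
      simp only [Finset.mem_image]
      constructor
      · rintro ⟨y, hy, rfl⟩
        exact hmem' y hy
      · intro hx
        exact hmem x hx fun hxa => ha (hxa ▸ hx)
  · rintro (⟨δ, ⟨hw, hs⟩, rfl⟩ | ⟨δ, ⟨hw, hs⟩, rfl⟩)
    · refine ⟨by rw [weight_cons', weight_cons', hw], ?_⟩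
      rw [slots_cons', slots_cons']
      exact Finset.insert_subset_insert _ (Finset.image_subset_image hs)
    · refine ⟨by rw [weight_cons', weight_merge, hw], ?_⟩
      rw [slots_cons', slots_merge]
      exact (Finset.image_subset_image hs).trans (Finset.subset_insert _ _)

theorem sum_coarsenings_cons {M : Type*} [AddCommMonoid M] (a : ℕ+) (β : MultiIndex)
    (F : MultiIndex → M) :
    ∑ γ ∈ (cons a β).coarsenings, F γ = ∑ γ ∈ β.coarsenings, (F (cons a γ) + F (merge a γ)) := by
  classical
  rw [coarsenings_cons, Finset.sum_union, Finset.sum_image (cons_injective a).injOn,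
    Finset.sum_image (merge_injective a).injOn, Finset.sum_add_distrib]
  rw [Finset.disjoint_left]
  intro γ h1 h2
  obtain ⟨δ, -, rfl⟩ := Finset.mem_image.1 h1
  obtain ⟨ε, -, h⟩ := Finset.mem_image.1 h2
  apply notMem_slots_merge a ε
  rw [h, slots_cons']
  exact Finset.mem_insert_self _ _

theorem sum_coarsenings_merge {M : Type*} [AddCommMonoid M] (a : ℕ+) (β : MultiIndex)
    (F : MultiIndex → M) :
    ∑ γ ∈ (merge a β).coarsenings, F γ = ∑ γ ∈ β.coarsenings, F (merge a γ) := by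
  classical
  have h : (merge a β).coarsenings = β.coarsenings.image (merge a) := by
    ext γ
    have h1 : γ ∈ (merge a β).coarsenings ↔ γ ∈ (cons a β).coarsenings ∧ (a : ℕ) ∉ γ.slots := by
      rw [mem_coarsenings, mem_coarsenings, weight_merge, weight_cons', slots_cons', slots_merge]
      constructor
      · rintro ⟨hw, hs⟩
        refine ⟨⟨hw, hs.trans (Finset.subset_insert _ _)⟩, fun h => ?_⟩
        exact notMem_slots_merge a β (by rw [slots_merge]; exact hs h)
      · rintro ⟨⟨hw, hs⟩, h⟩
        exact ⟨hw, (Finset.subset_insert_iff_of_notMem h).1 hs⟩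
    rw [h1, coarsenings_cons, Finset.mem_union]
    simp only [Finset.mem_image]
    constructor
    · rintro ⟨⟨δ, -, rfl⟩ | h, h'⟩
      · rw [slots_cons'] at h'
        exact absurd (Finset.mem_insert_self _ _) h'
      · exact h
    · rintro ⟨δ, hδ, rfl⟩
      exact ⟨Or.inr ⟨δ, hδ, rfl⟩, notMem_slots_merge a δ⟩
  rw [h, Finset.sum_image (merge_injective a).injOn]

end MultiIndex

theorem topSum_single (a n : ℕ+) : topSum (single a) n = (n : ℝ≥0)⁻¹ ^ (a : ℕ) := by
  simp [topSum, single, head, tail, harmonicSum_nil]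

theorem topSum_cons (a : ℕ+) (β : MultiIndex) (n : ℕ+) :
    topSum (MultiIndex.cons a β) n =
      (n : ℝ≥0)⁻¹ ^ (a : ℕ) * ∑ m ∈ Finset.Iio n, topSum β m := by
  rw [← harmonicSum_entries]
  rfl

theorem topSum_merge (a : ℕ+) (β : MultiIndex) (n : ℕ+) :
    topSum (MultiIndex.merge a β) n = (n : ℝ≥0)⁻¹ ^ (a : ℕ) * topSum β n := by
  rw [topSum, topSum, ← mul_assoc, ← pow_add]
  rfl

/-- The map `d` turns strict inequalities into weak ones. -/
theorem sum_coarsenings_topSum (γ : MultiIndex) (n : ℕ+) :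
    ∑ β ∈ γ.coarsenings, topSum β n = weakSum γ.1 n := by
  induction γ using cons_induction generalizing n with
  | h1 a =>
    rw [coarsenings_single, Finset.sum_singleton, topSum_single]
    exact (weakStep_single a n).symm
  | h2 a β ih =>
    rw [sum_coarsenings_cons]
    simp only [topSum_cons, topSum_merge]
    rw [Finset.sum_add_distrib, ← Finset.mul_sum, ← Finset.mul_sum, Finset.sum_comm]
    simp only [ih]
    change _ = weakStep a (weakSum β.1) n
    rw [weakStep, ← Finset.Iio_insert, Finset.sum_insert (by simp)]
    ring

theorem dMap_basisV (α : MultiIndex) : dMap (basisV α) = ∑ β ∈ α.coarsenings, basisV β := by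
  simp [dMap, basisV]

theorem circ_basisV (α β : MultiIndex) : circ (basisV α) (basisV β) = circBasis α β := by
  simp [circ, basisV]

theorem topEval_circ_dMap (γ : MultiIndex) (k : ℕ) (hk : 1 ≤ k + 1) (n : ℕ+) :
    topEval n (circ (dMap (basisV γ)) (basisV (ones (k + 1) hk))) =
      (((n : ℝ≥0)⁻¹ * weakSum γ.1 n * esymmInv k n : ℝ≥0) : ℝ) := by
  have h : topSum (ones (k + 1) hk) n = (n : ℝ≥0)⁻¹ * esymmInv k n := by
    rw [← harmonicSum_replicate_one, topSum]
    simp [ones, head, tail, List.replicate_succ]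
  rw [dMap_basisV, map_sum, LinearMap.sum_apply, map_sum]
  simp only [circ_basisV, topEval_circBasis]
  rw [← Finset.sum_mul, h, ← sum_coarsenings_topSum]
  push_cast
  ring

theorem nestedSide_eq_zeta (α : MultiIndex) (k : ℕ) (hk : 1 ≤ k) :
    nestedSide α k = zeta (circ (dMap (basisV α.reverse)) (basisV (ones k hk))) := by
  obtain ⟨k, rfl⟩ : ∃ j, k = j + 1 := ⟨k - 1, by omega⟩
  rw [nestedSide_succ, ENNReal.tsum_toReal_eq fun _ => ENNReal.coe_ne_top,
    ← (hasSum_zeta _).tsum_eq]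
  exact tsum_congr fun n => (topEval_circ_dMap α.reverse k hk n).symm

/-! ### The case `k = 1` -/

namespace MultiIndex

theorem star_single_one : (single 1).star = single 1 := by
  refine slots_injective (weight_star _) ?_
  rw [slots_star, weight_single, single, slots_single]
  rfl

theorem star_cons_one (β : MultiIndex) : (cons 1 β).star = merge 1 β.star := by
  have hw := β.weight_pos
  refine slots_injective (by rw [weight_star, weight_cons', weight_merge, weight_star]) ?_
  rw [slots_star, weight_cons', slots_cons', slots_merge, slots_star]
  ext x
  simp only [Finset.mem_sdiff, Finset.mem_Ico, Finset.mem_insert, Finset.mem_image, PNat.one_coe]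
  constructor
  · rintro ⟨⟨h1, h2⟩, h3⟩
    push Not at h3
    refine ⟨x - 1, ⟨⟨by omega, by omega⟩, fun h => ?_⟩, by omega⟩
    exact h3.2 _ h (by omega)
  · rintro ⟨y, ⟨⟨h1, h2⟩, h3⟩, rfl⟩
    refine ⟨⟨by omega, by omega⟩, ?_⟩
    rintro (h | ⟨z, hz, h⟩)
    · omega
    · exact h3 (by rwa [show y = z by omega])

theorem star_merge_one (β : MultiIndex) : (merge 1 β).star = cons 1 β.star := by
  have hw := β.weight_pos
  refine slots_injective (by rw [weight_star, weight_cons', weight_merge, weight_star]) ?_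
  rw [slots_star, weight_merge, slots_cons', slots_merge, slots_star]
  ext x
  simp only [Finset.mem_sdiff, Finset.mem_Ico, Finset.mem_insert, Finset.mem_image, PNat.one_coe]
  constructor
  · rintro ⟨⟨h1, h2⟩, h3⟩
    push Not at h3
    by_cases hx : x = 1
    · exact Or.inl hx
    · refine Or.inr ⟨x - 1, ⟨⟨by omega, by omega⟩, fun h => ?_⟩, by omega⟩
      exact h3 _ h (by omega)
  · rintro (rfl | ⟨y, ⟨⟨h1, h2⟩, h3⟩, rfl⟩)
    · refine ⟨⟨le_rfl, by omega⟩, ?_⟩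
      rintro ⟨z, hz, h⟩
      have := pos_of_mem_slots hz
      omega
    · refine ⟨⟨by omega, by omega⟩, ?_⟩
      rintro ⟨z, hz, h⟩
      exact h3 (by rwa [show y = z by omega])

theorem sum_take_add_sum_drop (l : List ℕ+) (i : ℕ) :
    ((l.take i).map fun a : ℕ+ => (a : ℕ)).sum + ((l.drop i).map fun a : ℕ+ => (a : ℕ)).sum =
      (l.map fun a : ℕ+ => (a : ℕ)).sum := by
  rw [← List.sum_append, ← List.map_append, List.take_append_drop]

theorem weight_reverse (α : MultiIndex) : α.reverse.weight = α.weight := by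
  simp [weight, reverse]

theorem reverse_reverse (α : MultiIndex) : α.reverse.reverse = α :=
  MultiIndex.ext (List.reverse_reverse _)

theorem sub_mem_slots_reverse {α : MultiIndex} {x : ℕ} (hx : x ∈ α.slots) :
    α.weight - x ∈ α.reverse.slots := by
  obtain ⟨i, hi, rfl⟩ := Finset.mem_image.1 hx
  have hi' := Finset.mem_Ico.1 hi
  have hlen : α.reverse.length = α.length := List.length_reverse
  refine Finset.mem_image.2 ⟨α.length - i, Finset.mem_Ico.2 ⟨by omega, by omega⟩, ?_⟩
  have h := sum_take_add_sum_drop α.1 i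
  change ((α.1.reverse.take (α.1.length - i)).map fun a : ℕ+ => (a : ℕ)).sum =
    (α.1.map fun a : ℕ+ => (a : ℕ)).sum - _
  rw [List.take_reverse, Nat.sub_sub_self (by have := hi'.2; exact this.le), List.map_reverse,
    List.sum_reverse]
  omega

theorem slots_reverse_subset {α β : MultiIndex} (hw : α.weight = β.weight)
    (hs : β.slots ⊆ α.slots) : β.reverse.slots ⊆ α.reverse.slots := by
  intro x hx
  have h1 := sub_mem_slots_reverse hx
  have h2 := Finset.mem_Ico.1 (slots_subset _ hx)
  rw [reverse_reverse, weight_reverse] at h1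
  rw [weight_reverse] at h2
  have h3 := sub_mem_slots_reverse (hs h1)
  rwa [hw, Nat.sub_sub_self h2.2.le] at h3

theorem reverse_mem_coarsenings {α β : MultiIndex} (h : β ∈ α.coarsenings) :
    β.reverse ∈ α.reverse.coarsenings := by
  rw [mem_coarsenings] at h ⊢
  exact ⟨by rw [weight_reverse, weight_reverse, h.1], slots_reverse_subset h.1 h.2⟩

end MultiIndex

theorem dMap_basisV_reverse (α : MultiIndex) :
    dMap (basisV α.reverse) = tauMap (dMap (basisV α)) := by
  rw [dMap_basisV, dMap_basisV, map_sum]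
  refine Finset.sum_nbij' reverse reverse (fun β hβ => ?_) (fun β hβ => reverse_mem_coarsenings hβ)
    (fun β _ => reverse_reverse β) (fun β _ => reverse_reverse β) (fun β _ => ?_)
  · have := reverse_mem_coarsenings hβ
    rwa [reverse_reverse] at this
  · simp [tauMap, basisV, reverse_reverse]

theorem circ_one (v : V) : zeta (circ v (basisV (ones 1 le_rfl))) = zetaPlus v := by
  induction v using Finsupp.induction_linear with
  | zero => simp
  | add u v hu hv => simp only [map_add, LinearMap.add_apply, hu, hv]
  | single α c =>
    have h1 : circBasis α (ones 1 le_rfl) = Finsupp.single ⟨α.plus, α, rfl⟩ 1 := by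
      have h2 : harmonic α.tail (ones 1 le_rfl).tail = Finsupp.single α.tail 1 := by
        change harmonic α.tail [] = _
        cases α.tail <;> rw [harmonic]
      rw [circBasis, h2, Finsupp.mapDomain_single]
      rfl
    simp [circ, basisV, h1, zeta, zetaPlus]

/-- The nested sum with all exponents equal to `1` and top variable `n` that is cut into blocks of
the lengths `α₁, …, α_s`. -/
noncomputable def unitNest (α : MultiIndex) (n : ℕ+) : ℝ≥0 :=
  (n : ℝ≥0)⁻¹ * nest ((blockFlags α.1).tail.map fun w => (w, 1)) 1 n

theorem blockFlags_eq_cons (α : MultiIndex) : blockFlags α.1 = true :: (blockFlags α.1).tail := by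
  obtain ⟨l, hl⟩ := α
  cases l with
  | nil => exact absurd rfl hl
  | cons a l => rfl

theorem unitNest_cons_one (β : MultiIndex) (n : ℕ+) :
    unitNest (MultiIndex.cons 1 β) n = (n : ℝ≥0)⁻¹ * ∑ m ∈ Finset.Iic n, unitNest β m := by
  have h : (blockFlags (MultiIndex.cons 1 β).1).tail = true :: (blockFlags β.1).tail := by
    rw [← blockFlags_eq_cons]
    rfl
  rw [unitNest, h, List.map_cons, nest_cons, nestStep]
  simp [unitNest]

theorem unitNest_merge_one (β : MultiIndex) (n : ℕ+) :
    unitNest (merge 1 β) n = (n : ℝ≥0)⁻¹ * ∑ m ∈ Finset.Iio n, unitNest β m := by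
  have h : (blockFlags (merge 1 β).1).tail = false :: (blockFlags β.1).tail := by
    obtain ⟨l, hl⟩ := β
    cases l with
    | nil => exact absurd rfl hl
    | cons b l =>
      change (blockFlags ((1 + b) :: l)).tail = false :: (blockFlags (b :: l)).tail
      have hb : ((1 + b : ℕ+) : ℕ) - 1 = ((b : ℕ) - 1) + 1 := by
        have := b.pos
        rw [PNat.add_coe, PNat.one_coe]
        omega
      rw [blockFlags_cons, blockFlags_cons, hb, List.replicate_succ]
      rfl
  rw [unitNest, h, List.map_cons, nest_cons, nestStep]
  simp [unitNest]

/-- Splitting every weak inequality into a strict inequality and an equality. -/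
theorem unitNest_eq_sum (α : MultiIndex) (n : ℕ+) :
    unitNest α n = ∑ β ∈ α.coarsenings, topSum β.star n := by
  induction α using cons_merge_induction generalizing n with
  | h1 =>
    rw [coarsenings_single, Finset.sum_singleton, star_single_one, topSum_single]
    simp [unitNest, single, blockFlags, nest_nil]
  | h2 β ih =>
    rw [sum_coarsenings_cons, unitNest_cons_one]
    simp only [star_cons_one, star_merge_one, topSum_cons, topSum_merge, ih]
    rw [Finset.sum_add_distrib, ← Finset.mul_sum, ← Finset.mul_sum,
      Finset.sum_comm (s := β.coarsenings), ← Finset.Iio_insert, Finset.sum_insert (by simp),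
      mul_add]
    simp
  | h3 β ih =>
    rw [sum_coarsenings_merge, unitNest_merge_one]
    simp only [star_merge_one, topSum_cons, ih]
    rw [← Finset.mul_sum, Finset.sum_comm]
    simp

theorem hasSum_zetaPlus_starMap_dMap (α : MultiIndex) :
    HasSum (fun n : ℕ+ => (((n : ℝ≥0)⁻¹ * unitNest α n : ℝ≥0) : ℝ))
      (zetaPlus (starMap (dMap (basisV α)))) := by
  have h1 : zetaPlus (starMap (dMap (basisV α))) =
      ∑ β ∈ α.coarsenings, mzv ⟨β.star.plus, β.star, rfl⟩ := by
    rw [dMap_basisV, map_sum, map_sum]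
    simp [starMap, zetaPlus, basisV]
  rw [h1]
  have h2 := hasSum_sum fun (β : MultiIndex) (_ : β ∈ α.coarsenings) =>
    hasSum_mzv ⟨β.star.plus, β.star, rfl⟩
  refine h2.congr_fun fun n => ?_
  rw [unitNest_eq_sum]
  push_cast
  rw [Finset.mul_sum]
  refine Finset.sum_congr rfl fun β _ => ?_
  rw [plus_eq_merge, topSum_merge]
  simp

theorem blocksLetters_zero (l : List ℕ+) (κ : Fin l.length → ℕ) (hκ : κ = 0) :
    blocksLetters l κ = (blockFlags l).map fun w => (w, 1) := by
  subst hκ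
  induction l with
  | nil => rfl
  | cons a l ih =>
    have h := blocksLetters_cons a l 0
    refine h.trans ?_
    rw [blockFlags_cons, List.map_cons, List.map_append]
    refine (congrArg (blockLetters a 0 ++ ·) ih).trans ?_
    simp [blockLetters]

theorem filter_piAntidiag_one (r : ℕ) (hr : 0 < r) :
    (Finset.piAntidiag (Finset.univ : Finset (Fin r)) 1).filter (fun κ => 1 ≤ κ ⟨0, hr⟩) =
      {Pi.single ⟨0, hr⟩ 1} := by
  ext κ
  rw [Finset.mem_filter, Finset.mem_piAntidiag, Finset.mem_singleton]
  constructor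
  · rintro ⟨⟨h1, -⟩, h2⟩
    rw [← Finset.add_sum_erase _ _ (Finset.mem_univ (⟨0, hr⟩ : Fin r))] at h1
    have h3 : ∑ i ∈ Finset.univ.erase (⟨0, hr⟩ : Fin r), κ i = 0 := by omega
    have h4 : κ ⟨0, hr⟩ = 1 := by omega
    rw [Finset.sum_eq_zero_iff] at h3
    funext i
    by_cases hi : i = ⟨0, hr⟩
    · subst hi
      simp [h4]
    · rw [h3 i (Finset.mem_erase.2 ⟨hi, Finset.mem_univ _⟩), Pi.single_eq_of_ne hi]
  · rintro rfl
    simp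

theorem nestedSide_one (α : MultiIndex) :
    nestedSide α 1 = zetaPlus (starMap (dMap (basisV α))) := by
  rw [nestedSide, filter_piAntidiag_one, Finset.sum_singleton, nestedZeta_expand,
    ENNReal.tsum_toReal_eq fun _ => ENNReal.coe_ne_top, ← (hasSum_zetaPlus_starMap_dMap α).tsum_eq]
  have h : ∀ κ : Fin α.length → ℕ, κ = Pi.single ⟨0, α.length_pos⟩ 1 →
      (blocksLetters α.1 κ).tail = (blockFlags α.1).tail.map fun w => (w, 1) := by
    rintro _ rfl
    obtain ⟨l, hl⟩ := α
    cases l with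
    | nil => exact absurd rfl hl
    | cons a l =>
      refine (congrArg List.tail (blocksLetters_cons a l (Pi.single 0 1))).trans ?_
      rw [blocksLetters_zero l _ (by funext i; simp)]
      simp [blockFlags_cons, blockLetters]
  refine tsum_congr fun n => ?_
  rw [h _ rfl, unitNest]
  simp [pow_two, mul_assoc]

/-! ### The span of the relations -/

theorem range_dMap : LinearMap.range dMap = ⊤ := by
  have h : ∀ (c : ℕ) (α : MultiIndex), α.slots.card = c → basisV α ∈ LinearMap.range dMap := by
    intro c
    induction c using Nat.strong_induction_on with
    | _ c ih =>
      intro α hα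
      classical
      have hmem : α ∈ α.coarsenings := mem_coarsenings.2 ⟨rfl, subset_rfl⟩
      have h1 := dMap_basisV α
      rw [← Finset.add_sum_erase _ _ hmem] at h1
      rw [← sub_eq_iff_eq_add] at h1
      rw [← h1]
      refine Submodule.sub_mem _ (LinearMap.mem_range_self _ _) (Submodule.sum_mem _ fun β hβ => ?_)
      rw [Finset.mem_erase, mem_coarsenings] at hβ
      refine ih _ ?_ β rfl
      rw [← hα]
      refine Finset.card_lt_card (hβ.2.2.ssubset_of_ne fun h => hβ.1 ?_)
      exact slots_injective hβ.2.1.symm h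
  rw [eq_top_iff]
  rintro v -
  induction v using Finsupp.induction_linear with
  | zero => exact Submodule.zero_mem _
  | add u v hu hv => exact Submodule.add_mem _ hu hv
  | single α c =>
    have : Finsupp.single α c = c • basisV α := by simp [basisV]
    rw [this]
    exact Submodule.smul_mem _ _ (h _ α rfl)

end MZV

theorem proposition4p30 :
    -- all the series involved converge
    (∀ (α μ : MZV.MultiIndex) (h : μ.length = α.weight), μ.Admissible →
      Summable (MZV.nestedTerm α μ h)) ∧
    -- the identity, for all multi-indices and all `k ≥ 1`
    (∀ (α : MZV.MultiIndex) (k : ℕ) (hk : 1 ≤ k),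
      MZV.nestedSide α k =
        MZV.zeta (MZV.circ (MZV.dMap (MZV.basisV α.reverse))
          (MZV.basisV (MZV.MultiIndex.ones k hk)))) ∧
    -- for `k = 1` the two sides are the values of `ζ⁺` at `∗d(α)` and at `τd(α)`
    (∀ α : MZV.MultiIndex,
      MZV.nestedSide α 1 = MZV.zetaPlus (MZV.starMap (MZV.dMap (MZV.basisV α))) ∧
      MZV.zeta (MZV.circ (MZV.dMap (MZV.basisV α.reverse))
          (MZV.basisV (MZV.MultiIndex.ones 1 le_rfl))) =
        MZV.zetaPlus (MZV.tauMap (MZV.dMap (MZV.basisV α)))) ∧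
    -- the relations of the case `k = 1` span the same space as the duality relations
    LinearMap.range ((MZV.starMap - MZV.tauMap) ∘ₗ MZV.dMap) =
      LinearMap.range (MZV.starMap - MZV.tauMap) := by
  refine ⟨MZV.summable_nestedTerm, MZV.nestedSide_eq_zeta, fun α => ⟨MZV.nestedSide_one α, ?_⟩,
    LinearMap.range_comp_of_range_eq_top _ MZV.range_dMap⟩
  rw [MZV.dMap_basisV_reverse, MZV.circ_one]
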